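/- **Theorem (Uniqueness of the invariant state).** Let $\beta>0$, $m\in\mathbb N$ with $m\ge 1$, $n\in\mathbb N$, and consider one of the following two settings. 1. $\mathcal H=L^2(\mathbb R)$, $a=\tfrac1{\sqrt2}(x+\tfrac{d}{dx})$, $a^\dagger=\tfrac1{\sqrt2}(x-\tfrac{d}{dx})$, $N=a^\dagger a$, with jump operators $\{A^\alpha\}=\{a,a^\dagger\}$ (all operators closed from the Schwartz functions); 2. $\mathcal H=L^2(\mathbb R/2\pi\mathbb Z)$, $D_x=-i\tfrac{d}{dx}$, $N=D_x^2=-\Delta$, with jump operators $\{A^\alpha\}=\{D_x,e^{ix},e^{-ix}\}$ (all operators closed from the smooth functions). Let $H=N^m+K$, where $K\in\mathcal B(\mathcal H)$ is self-adjoint, of finite rank, and satisfies $K=1_{[0,n]}(N)\,K\,1_{[0,n]}(N)$. Let $\operatorname{Sp}(H)$ be the (discrete) spectrum of $H$, $P_E$ the orthogonal projection onto $\ker(H-E)$ (so $P_E=0$ if $E\notin \operatorname{Sp}(H)$), and $B(H)=\operatorname{Sp}(H)-\operatorname{Sp}(H)$ the set of Bohr frequencies. Let $\widehat f:\mathbb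 R\to\mathbb C$ satisfy $\overline{\widehat f(\nu)}=\widehat f(-\nu)e^{-\beta\nu/2}$ for all $\nu\in\mathbb R$, $\sup_\nu|\widehat f(\nu)|<\infty$, $\sup_\nu e^{\beta\nu/2}|\widehat f(\nu)|<\infty$, and $\widehat f(\nu)\neq0$ for all $\nu\in B(H)$. Let $\mathscr T_2(\mathcal H)$ be the Hilbert space of Hilbert–Schmidt operators with $\langle x,y\rangle=\operatorname{Tr}(x^\dagger y)$, and let $\mathscr F_{\sigma_\beta}\subset\mathscr T_2(\mathcal H)$ be the span of $e^{-\beta H/2}$ and of all $|u\rangle\langle v|$ with $u,v$ eigenvectors of $H$. For $x\in\mathscr F_{\sigma_\beta}$ and $\nu\in B(H)$ put $$A^\alpha_\nu=\sum_{E\in\operatorname{Sp}(H)}P_{E+\nu}A^\alpha P_E,\qquad x^\alpha_\nu=\widehat f(\nu)\,e^{\beta\nu/4}\bigl(e^{-\beta\nu/4}A^\alpha_\nu x-e^{\beta\nu/4}xA^\alpha_\nu\bigr),$$ $$\mathcal E(x)=\sum_\alpha\sum_{\nu_1,\nu_2\in B(H)}\frac{\langle x^\alpha_{\nu_1},x^\alpha_{\nu_2}\rangle}{2\cosh((\nu_1-\nu_2)\beta/4)},$$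 where $e^{-\beta\nu/4}A^\alpha_\nu x-e^{\beta\nu/4}xA^\alpha_\nu$ is evaluated as $\sum_E\bigl(e^{-\beta\nu/4}P_{E+\nu}A^\alpha P_Ex-e^{\beta\nu/4}xP_{E+\nu}A^\alpha P_E\bigr)$; all these sums have finitely many non-zero terms. Denote by $\mathcal E_{\widehat f,H}$ the closure of the quadratic form $\mathcal E$ in $\mathscr T_2(\mathcal H)$. Then the kernel of the Dirichlet form $\mathcal E_{\widehat f,H}$ is spanned by $e^{-\beta H/2}$, i.e. by the square root of the Gibbs state: for every bounded operator $x$ on $\mathcal H$, $$x\in D(\mathcal E_{\widehat f,H})\ \text{ and }\ \mathcal E_{\widehat f,H}(x)=0\quad\Longleftrightarrow\quad x=c\,e^{-\beta H/2}\ \text{ for some } c\in\mathbb C .$$ -/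

import Mathlib

open MeasureTheory Filter Topology
open scoped InnerProductSpace ENNReal SchwartzMap ContDiff

noncomputable section

namespace GibbsSampler

/-! ### Operators given on an invariant core -/

section Core

variable {V X : Type*} [AddCommGroup V] [Module ℂ V]
  [NormedAddCommGroup X] [InnerProductSpace ℂ X]

/-- The unbounded operator on `X` whose domain is the image of the core `V` under the injective
linear map `ι : V → X` and which acts on that core as `T : V → V`. -/
def onCore (ι : V →ₗ[ℂ] X) (hι : Function.Injective ι) (T : V →ₗ[ℂ] V) : X →ₗ.[ℂ] X where
  domain := LinearMap.range ι
  toFun := ι ∘ₗ T ∘ₗ (LinearEquiv.ofInjective ι hι).symm.toLinearMap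

/-- The closed operator on `X` obtained by closing `T` from the core `V`. -/
def closedOp (ι : V →ₗ[ℂ] X) (hι : Function.Injective ι) (T : V →ₗ[ℂ] V) : X →ₗ.[ℂ] X :=
  (onCore ι hι T).closure

end Core

/-! ### Spectral data of an operator with pure point spectrum -/

section Spectral

variable {X : Type*} [NormedAddCommGroup X] [InnerProductSpace ℂ X]

/-- The sum `T + K` of an unbounded operator and a bounded one, with domain `D(T)`. -/
def addBounded (T : X →ₗ.[ℂ] X) (K : X →L[ℂ] X) : X →ₗ.[ℂ] X where
  domain := T.domain
  toFun := T.toFun + K.toLinearMap ∘ₗ T.domain.subtype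

/-- The eigenspace `ker (H - E)`. -/
def eigenspace (H : X →ₗ.[ℂ] X) (E : ℝ) : Submodule ℂ X where
  carrier := {v | ∃ h : v ∈ H.domain, H ⟨v, h⟩ = (E : ℂ) • v}
  zero_mem' := ⟨H.domain.zero_mem, by
    rw [smul_zero]; exact H.map_zero⟩
  add_mem' := by
    rintro a b ⟨ha, ha'⟩ ⟨hb, hb'⟩
    refine ⟨H.domain.add_mem ha hb, ?_⟩
    rw [smul_add, ← ha', ← hb']
    exact H.map_add ⟨a, ha⟩ ⟨b, hb⟩
  smul_mem' := by
    rintro c a ⟨ha, ha'⟩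
    refine ⟨H.domain.smul_mem c ha, ?_⟩
    rw [smul_comm, ← ha']
    exact H.map_smul c ⟨a, ha⟩

/-- The energy levels of `H`: its eigenvalues. For the Hamiltonians considered here (discrete
spectrum) this is the whole spectrum. -/
def energies (H : X →ₗ.[ℂ] X) : Set ℝ := {E | eigenspace H E ≠ ⊥}

/-- The Bohr frequencies `Sp(H) - Sp(H)`. -/
def bohrFrequencies (H : X →ₗ.[ℂ] X) : Set ℝ :=
  {ν | ∃ E ∈ energies H, ∃ E' ∈ energies H, ν = E - E'}

variable [CompleteSpace X]

/-- The orthogonal projection `P_E` onto the eigenspace of `H` at `E`; it is `0` when `E` is not an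
eigenvalue. -/
def eigenProj (H : X →ₗ.[ℂ] X) (E : ℝ) : X →L[ℂ] X :=
  (eigenspace H E).topologicalClosure.starProjection

/-- The spectral projection `1_S(N)` of an operator `N` with pure point spectrum: the orthogonal
projection onto the closed span of the eigenspaces with eigenvalue in `S`. -/
def spectralProj (N : X →ₗ.[ℂ] X) (S : Set ℝ) : X →L[ℂ] X :=
  (⨆ E ∈ S, eigenspace N E).topologicalClosure.starProjection

open scoped Classical in
/-- The bounded operator `e^{-sH} = ∑_E e^{-sE} P_E` (strongly convergent sum over the energies),
for an operator `H` with pure point spectrum. -/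
def expNeg (H : X →ₗ.[ℂ] X) (s : ℝ) : X →L[ℂ] X :=
  if h : ∃ G : X →L[ℂ] X, ∀ v,
      HasSum (fun E : ℝ => (Real.exp (-(s * E)) : ℂ) • eigenProj H E v) (G v)
  then h.choose else 0

open scoped Classical in
/-- The bounded operator `P_{E'} A P_E`, for an unbounded operator `A` whose domain contains the
eigenvectors of `H`. -/
def energyBlock (H A : X →ₗ.[ℂ] X) (E' E : ℝ) : X →L[ℂ] X :=
  if h : ∃ T : X →L[ℂ] X, ∀ v, ∃ hv : eigenProj H E v ∈ A.domain,
      T v = eigenProj H E' (A ⟨eigenProj H E v, hv⟩)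
  then h.choose else 0

/-! ### Hilbert–Schmidt operators -/

variable (X) in
/-- The index set (a set of unit vectors) of some orthonormal basis of `X`. -/
def onbSet : Set X := (exists_hilbertBasis ℂ X).choose

/-- The square of the Hilbert–Schmidt norm, `∑_i ‖x b_i‖²` for an orthonormal basis `b` of `X`
(the value does not depend on the basis). -/
def hsNormSq (x : X →L[ℂ] X) : ℝ≥0∞ := ∑' b : onbSet X, ‖x b‖ₑ ^ 2

/-- `x` belongs to the Hilbert–Schmidt class `𝒯₂`. -/
def IsHilbertSchmidt (x : X →L[ℂ] X) : Prop := hsNormSq x < ⊤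

/-- The Hilbert–Schmidt inner product `Tr (x† y) = ∑_i ⟪x b_i, y b_i⟫`. -/
def hsInner (x y : X →L[ℂ] X) : ℂ := ∑' b : onbSet X, ⟪x b, y b⟫_ℂ

/-! ### The Dirichlet form -/

/-- `span {|u⟩⟨v|}` over eigenvectors `u, v` of `H`. -/
def finiteEnergyOps (H : X →ₗ.[ℂ] X) : Submodule ℂ (X →L[ℂ] X) :=
  Submodule.span ℂ {x | ∃ E E' : ℝ, ∃ u ∈ eigenspace H E, ∃ v ∈ eigenspace H E',
    x = InnerProductSpace.rankOne ℂ u v}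

/-- The domain of the (not yet closed) form: the span of `finiteEnergyOps H` and of the square
root of the Gibbs state, which is a positive multiple of `e^{-βH/2}`. -/
def formCore (β : ℝ) (H : X →ₗ.[ℂ] X) : Submodule ℂ (X →L[ℂ] X) :=
  finiteEnergyOps H ⊔ Submodule.span ℂ {expNeg H (β / 2)}

/-- `δ_ν(x) = e^{-βν/4} A_ν x - e^{βν/4} x A_ν`, where `A_ν = ∑_E P_{E+ν} A P_E` is the part of the
jump `A` that raises the energy by `ν`. On `formCore β H`, and for jumps mapping the span of the
eigenvectors of `H` into itself together with their adjoints, only finitely many terms are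
non-zero; in particular every term vanishes for `x = e^{-βH/2}`. -/
def delta (β : ℝ) (H A : X →ₗ.[ℂ] X) (ν : ℝ) (x : X →L[ℂ] X) : X →L[ℂ] X :=
  ∑' E : ℝ, ((Real.exp (-(β * ν / 4)) : ℂ) • (energyBlock H A (E + ν) E ∘L x)
    - (Real.exp (β * ν / 4) : ℂ) • (x ∘L energyBlock H A (E + ν) E))

/-- `x_ν = f̂(ν) e^{βν/4} δ_ν(x)`. -/
def component (β : ℝ) (f : ℝ → ℂ) (H A : X →ₗ.[ℂ] X) (x : X →L[ℂ] X) (ν : ℝ) : X →L[ℂ] X :=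
  (f ν * (Real.exp (β * ν / 4) : ℂ)) • delta β H A ν x

/-- The form on its core:
`ℰ(x) = ∑_α ∑_{ν₁,ν₂} (2 cosh ((ν₁-ν₂)β/4))⁻¹ ⟨x^α_{ν₁}, x^α_{ν₂}⟩`.
(Terms with `ν₁` or `ν₂` not a Bohr frequency vanish.) -/
def coreForm {α : Type*} [Fintype α] (β : ℝ) (f : ℝ → ℂ) (H : X →ₗ.[ℂ] X)
    (A : α → X →ₗ.[ℂ] X) (x : X →L[ℂ] X) : ℝ :=
  ∑ i, (∑' ν : ℝ × ℝ, ((1 / (2 * Real.cosh ((ν.1 - ν.2) * β / 4)) : ℝ) : ℂ) *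
    hsInner (component β f H (A i) x ν.1) (component β f H (A i) x ν.2)).re

/-- `x` lies in the domain of the closure of the form and the closed form takes the value `r` at
`x`: there are `z n` in the core with `z n → x` in Hilbert–Schmidt norm, Cauchy for the form, and
`ℰ(z n) → r`. -/
def ClosedFormHasValue {α : Type*} [Fintype α] (β : ℝ) (f : ℝ → ℂ) (H : X →ₗ.[ℂ] X)
    (A : α → X →ₗ.[ℂ] X) (x : X →L[ℂ] X) (r : ℝ) : Prop :=
  IsHilbertSchmidt x ∧ ∃ z : ℕ → X →L[ℂ] X, (∀ n, z n ∈ formCore β H) ∧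
    Tendsto (fun n => hsNormSq (z n - x)) atTop (𝓝 0) ∧
    Tendsto (fun p : ℕ × ℕ => coreForm β f H A (z p.1 - z p.2)) atTop (𝓝 0) ∧
    Tendsto (fun n => coreForm β f H A (z n)) atTop (𝓝 r)

end Spectral

/-- Filter functions: the KMS symmetry `conj f̂(ν) = f̂(-ν) e^{-βν/2}` and boundedness of
`f̂(ν)` and of `e^{βν/2} f̂(ν)`. -/
structure IsFilterFunction (β : ℝ) (f : ℝ → ℂ) : Prop where
  kms : ∀ ν, (starRingEnd ℂ) (f ν) = f (-ν) * (Real.exp (-(β * ν / 2)) : ℂ)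
  bounded : ∃ C : ℝ, ∀ ν, ‖f ν‖ ≤ C ∧ Real.exp (β * ν / 2) * ‖f ν‖ ≤ C

/-! ### The line: `L²(ℝ)` with `a`, `a†` and `N = a† a` -/

abbrev L2Line : Type := Lp ℂ 2 (volume : Measure ℝ)

def schwartzToL2 : 𝓢(ℝ, ℂ) →ₗ[ℂ] L2Line :=
  (SchwartzMap.toLpCLM ℂ ℂ 2 (volume : Measure ℝ)).toLinearMap

theorem schwartzToL2_injective : Function.Injective schwartzToL2 :=
  SchwartzMap.injective_toLp 2 (volume : Measure ℝ)

/-- Multiplication by the coordinate, `(x φ)(x) = x φ(x)`, on Schwartz functions. -/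
def positionS : 𝓢(ℝ, ℂ) →ₗ[ℂ] 𝓢(ℝ, ℂ) :=
  (SchwartzMap.smulLeftCLM ℂ (fun x : ℝ => (x : ℂ))).toLinearMap

def derivS : 𝓢(ℝ, ℂ) →ₗ[ℂ] 𝓢(ℝ, ℂ) := (SchwartzMap.derivCLM ℂ ℂ).toLinearMap

/-- `a = (x + d/dx) / √2` on Schwartz functions. -/
def annihilationS : 𝓢(ℝ, ℂ) →ₗ[ℂ] 𝓢(ℝ, ℂ) :=
  ((1 / Real.sqrt 2 : ℝ) : ℂ) • (positionS + derivS)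

/-- `a† = (x - d/dx) / √2` on Schwartz functions. -/
def creationS : 𝓢(ℝ, ℂ) →ₗ[ℂ] 𝓢(ℝ, ℂ) :=
  ((1 / Real.sqrt 2 : ℝ) : ℂ) • (positionS - derivS)

/-- The power `N^m` of the number operator `N = a† a`, closed from the Schwartz functions. -/
def numberPow (m : ℕ) : L2Line →ₗ.[ℂ] L2Line :=
  closedOp schwartzToL2 schwartzToL2_injective ((creationS * annihilationS) ^ m)

/-- The jumps `{a, a†}`. -/
def lineJumps : Fin 2 → L2Line →ₗ.[ℂ] L2Line :=
  ![closedOp schwartzToL2 schwartzToL2_injective annihilationS,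
    closedOp schwartzToL2 schwartzToL2_injective creationS]

/-! ### The circle: `L²(ℝ/2πℤ)` with `D_x`, `e^{ix}`, `e^{-ix}` and `N = D_x²` -/

instance fact_two_pi_pos : Fact (0 < 2 * Real.pi) := ⟨Real.two_pi_pos⟩

/-- `L²` of the circle for the normalized Haar measure `dx / 2π`. -/
abbrev L2Circle : Type := Lp ℂ 2 (AddCircle.haarAddCircle (T := 2 * Real.pi))

/-- Smooth `2π`-periodic functions. -/
def smoothPeriodic : Submodule ℂ (ℝ → ℂ) where
  carrier := {φ | ContDiff ℝ ∞ φ ∧ Function.Periodic φ (2 * Real.pi)}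
  zero_mem' := ⟨contDiff_const, fun _ => rfl⟩
  add_mem' := fun ha hb => ⟨ha.1.add hb.1, ha.2.add hb.2⟩
  smul_mem' := fun c _ ha => ⟨contDiff_const.smul ha.1, ha.2.smul c⟩

/-- A smooth periodic function as a continuous function on the circle. -/
def periodicToCircle : smoothPeriodic →ₗ[ℂ] C(AddCircle (2 * Real.pi), ℂ) where
  toFun φ := ⟨φ.2.2.lift, continuous_coinduced_dom.mpr φ.2.1.continuous⟩
  map_add' φ ψ := by
    ext x
    induction x using QuotientAddGroup.induction_on
    rfl
  map_smul' c φ := by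
    ext x
    induction x using QuotientAddGroup.induction_on
    rfl

def periodicToL2 : smoothPeriodic →ₗ[ℂ] L2Circle :=
  (ContinuousMap.toLp (E := ℂ) 2 (AddCircle.haarAddCircle (T := 2 * Real.pi)) ℂ).toLinearMap ∘ₗ
    periodicToCircle

theorem periodicToL2_injective : Function.Injective periodicToL2 := by
  refine (ContinuousMap.toLp_injective (AddCircle.haarAddCircle (T := 2 * Real.pi))).comp ?_
  intro φ ψ h
  ext x
  exact DFunLike.congr_fun h (x : AddCircle (2 * Real.pi))

/-- `D_x = -i d/dx` on smooth periodic functions. -/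
def momentumS : smoothPeriodic →ₗ[ℂ] smoothPeriodic where
  toFun φ := ⟨fun x => -Complex.I * deriv (φ : ℝ → ℂ) x,
    contDiff_const.mul (contDiff_infty_iff_deriv.mp φ.2.1).2, fun x => by
      have h : (fun y => (φ : ℝ → ℂ) (y + 2 * Real.pi)) = φ := funext φ.2.2
      simp only
      rw [← deriv_comp_add_const, h]⟩
  map_add' φ ψ := by
    ext x
    have hφ := (contDiff_infty_iff_deriv.mp φ.2.1).1 x
    have hψ := (contDiff_infty_iff_deriv.mp ψ.2.1).1 x
    simp [deriv_add hφ hψ, mul_add]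
  map_smul' c φ := by
    ext x
    have hφ := (contDiff_infty_iff_deriv.mp φ.2.1).1 x
    simp [deriv_const_smul c hφ]
    ring

/-- Multiplication by `e^{ikx}` on smooth periodic functions. -/
def phaseS (k : ℤ) : smoothPeriodic →ₗ[ℂ] smoothPeriodic where
  toFun φ := ⟨fun x => Complex.exp (Complex.I * k * x) * (φ : ℝ → ℂ) x,
    (Complex.contDiff_exp.comp
      (contDiff_const.mul Complex.ofRealCLM.contDiff)).mul φ.2.1, fun x => by
      have h : Complex.I * k * ((x + 2 * Real.pi : ℝ) : ℂ)
          = Complex.I * k * x + k * (2 * Real.pi * Complex.I) := by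
        push_cast; ring
      simp only
      rw [φ.2.2 x, h, Complex.exp_periodic.int_mul k]⟩
  map_add' φ ψ := by ext x; simp [mul_add]
  map_smul' c φ := by ext x; simp; ring

/-- The power `N^m` of `N = D_x² = -Δ`, closed from the smooth functions. -/
def laplacianPow (m : ℕ) : L2Circle →ₗ.[ℂ] L2Circle :=
  closedOp periodicToL2 periodicToL2_injective ((momentumS * momentumS) ^ m)

/-- The jumps `{D_x, e^{ix}, e^{-ix}}`. -/
def circleJumps : Fin 3 → L2Circle →ₗ.[ℂ] L2Circle :=
  ![closedOp periodicToL2 periodicToL2_injective momentumS,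
    closedOp periodicToL2 periodicToL2_injective (phaseS 1),
    closedOp periodicToL2 periodicToL2_injective (phaseS (-1))]

/-! ### Admissible perturbations and the kernel statement -/

/-- `K` is a bounded self-adjoint finite-rank operator with `K = 1_{[0,n]}(N) K 1_{[0,n]}(N)`. -/
structure IsLowEnergyPerturbation {X : Type*} [NormedAddCommGroup X] [InnerProductSpace ℂ X]
    [CompleteSpace X] (N : X →ₗ.[ℂ] X) (n : ℕ) (K : X →L[ℂ] X) : Prop where
  selfAdjoint : IsSelfAdjoint K
  finiteRank : FiniteDimensional ℂ (LinearMap.range K.toLinearMap)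
  lowEnergy : K = spectralProj N (Set.Icc 0 (n : ℝ)) ∘L K ∘L spectralProj N (Set.Icc 0 (n : ℝ))

end GibbsSampler

end

/-!
Fix a jump `A` and an eigenbasis `g` of `H` with energies `E`. The proof has an analytic and an
algebraic half.

*From the form to commutation.* The kernel `1 / (2 cosh ((μ - ν) β / 4))` is the Gram matrix of the
functions `r ↦ e^{μβ/4} exp (-e^{μβ/2} r)` on `(0, ∞)`, which are linearly independent for distinct
`μ`; so it is strictly positive definite (`eq_zero_of_sum_sechKernel_re_nonpos`). By the Schur
product argument the form on its core dominates the same expression built from one matrix element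
`⟪g j, x_ν (g i)⟫` of the components (`IsGibbsEigenbasis.sum_deltaEntry_le_coreForm`). This
expression involves finitely many frequencies and finitely many matrix elements of `x`, so it is
continuous in Hilbert–Schmidt norm, and the bound survives the closure. If the closed form vanishes
at `x`, every matrix element of every `δ_ν(x)` is therefore zero at the Bohr frequencies, where the
filter function does not vanish, and trivially elsewhere (`IsGibbsEigenbasis.deltaEntry_eq_zero`).
Multiplying by Boltzmann factors and summing over `ν` says that the sesquilinear form of
`e^{βH/4} x e^{βH/4}` on the algebraic span of the eigenbasis commutes with every jump
(`IsGibbsEigenbasis.gibbsForm_jump`).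

*Irreducibility.* A low-energy perturbation `K` of a diagonal operator changes only a
finite-dimensional block, so `H = N^m + K` has an eigenbasis with the same algebraic span as the
eigenbasis of `N` (`IsDiagonalCore.exists_isGibbsEigenbasis`). The commutation relation may thus be
tested on the plane waves or the Hermite functions. There it forces the form to be diagonal with a
constant diagonal, that is, a multiple of the inner product, whence `x = c e^{-βH/2}`
(`circle_kernel`, `line_kernel`). Conversely each `δ_ν` annihilates `e^{-βH/2}` term by term
(`IsGibbsEigenbasis.deltaTerm_expNeg`).

For the line, the Hermite functions are generated from the Gaussian by the creation operator. They
are complete because the moments of `e^{-x²/2} f` determine its Fourier transform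
(`eq_zero_of_forall_inner_hermiteS`).
-/

noncomputable section

namespace GibbsSampler

/-! ### Positivity of the kernel `1 / (2 cosh ((a - b) β / 4))` -/

/-- The feature functions `φ_a(r) = e^{aβ/4} exp (-e^{aβ/2} r)` on `(0, ∞)`; their Gram matrix is
the kernel `1 / (2 cosh ((a - b) β / 4))`. -/
def sechFeature (β a r : ℝ) : ℝ :=
  Real.exp (a * β / 4) * Real.exp (-(Real.exp (a * β / 2) * r))

/-- The kernel `1 / (2 cosh ((a - b) β / 4))` that weights pairs of Bohr frequencies in the form. -/
def sechKernel (β a b : ℝ) : ℝ := 1 / (2 * Real.cosh ((a - b) * β / 4))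

theorem sechFeature_mul (β a b r : ℝ) : sechFeature β a r * sechFeature β b r =
    (Real.exp (a * β / 4) * Real.exp (b * β / 4)) *
      Real.exp (-(Real.exp (a * β / 2) + Real.exp (b * β / 2)) * r) := by
  have : -(Real.exp (a * β / 2) + Real.exp (b * β / 2)) * r =
    -(Real.exp (a * β / 2) * r) + -(Real.exp (b * β / 2) * r) := by ring
  rw [this, Real.exp_add, sechFeature, sechFeature]; ring

theorem integrableOn_sechFeature_mul (β a b : ℝ) :
    IntegrableOn (fun r => sechFeature β a r * sechFeature β b r) (Set.Ioi 0) := by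
  simp_rw [sechFeature_mul]
  refine Integrable.const_mul ?_ _
  have hp := Real.exp_pos (a * β / 2)
  have hq := Real.exp_pos (b * β / 2)
  exact integrableOn_exp_mul_Ioi (by linarith) 0

theorem integral_sechFeature_mul (β a b : ℝ) :
    ∫ r in Set.Ioi (0 : ℝ), sechFeature β a r * sechFeature β b r = sechKernel β a b := by
  simp_rw [sechFeature_mul]
  have hp := Real.exp_pos (a * β / 2)
  have hq := Real.exp_pos (b * β / 2)
  rw [integral_const_mul, integral_exp_mul_Ioi (by linarith) 0, sechKernel, Real.cosh_eq]
  have h1 : Real.exp (a * β / 2) = Real.exp (a * β / 4) * Real.exp (a * β / 4) := by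
    rw [← Real.exp_add]; ring_nf
  have h2 : Real.exp (b * β / 2) = Real.exp (b * β / 4) * Real.exp (b * β / 4) := by
    rw [← Real.exp_add]; ring_nf
  have h3 : Real.exp ((a - b) * β / 4) = Real.exp (a * β / 4) / Real.exp (b * β / 4) := by
    rw [← Real.exp_sub]; ring_nf
  have h4 : Real.exp (-((a - b) * β / 4)) = Real.exp (b * β / 4) / Real.exp (a * β / 4) := by
    rw [← Real.exp_sub]; ring_nf
  rw [h1, h2, h3, h4]
  have := Real.exp_pos (a * β / 4)
  have := Real.exp_pos (b * β / 4)
  simp only [mul_zero, Real.exp_zero]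
  field_simp

theorem sum_sechKernel_mul (β : ℝ) (S : Finset ℝ) (m : ℝ → ℝ → ℝ) :
    ∑ a ∈ S, ∑ b ∈ S, sechKernel β a b * m a b =
      ∫ r in Set.Ioi (0 : ℝ),
        ∑ a ∈ S, ∑ b ∈ S, sechFeature β a r * sechFeature β b r * m a b := by
  rw [integral_finsetSum _ fun a _ => integrable_finsetSum _ fun b _ =>
    (integrableOn_sechFeature_mul β a b).mul_const _]
  refine Finset.sum_congr rfl fun a _ => ?_
  rw [integral_finsetSum _ fun b _ => (integrableOn_sechFeature_mul β a b).mul_const _]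
  refine Finset.sum_congr rfl fun b _ => ?_
  rw [integral_mul_const, integral_sechFeature_mul]

/-- The Schur product of the kernel with a positive semidefinite form has a nonnegative sum of
entries. -/
theorem sum_sechKernel_mul_nonneg (β : ℝ) (S : Finset ℝ) (m : ℝ → ℝ → ℝ)
    (hm : ∀ t : ℝ → ℝ, 0 ≤ ∑ a ∈ S, ∑ b ∈ S, t a * t b * m a b) :
    0 ≤ ∑ a ∈ S, ∑ b ∈ S, sechKernel β a b * m a b := by
  rw [sum_sechKernel_mul]
  exact integral_nonneg fun r => hm fun a => sechFeature β a r

/-- A finite combination of exponentials with distinct rates that vanishes on `(0, ∞)` has zero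
coefficients: sampling at `1, 2, …` gives a Vandermonde system. -/
theorem eq_zero_of_sum_sechFeature_eq_zero {β : ℝ} (hβ : 0 < β) (S : Finset ℝ) (c : ℝ → ℝ)
    (h : ∀ r > 0, ∑ a ∈ S, c a * sechFeature β a r = 0) : ∀ a ∈ S, c a = 0 := by
  let q : ℝ → ℝ := fun a => Real.exp (-(Real.exp (a * β / 2)))
  have hq : Function.Injective q := by
    intro a b hab
    have h1 := Real.exp_injective hab
    have h2 := Real.exp_injective (neg_injective h1)
    have : a * β = b * β := by linarith
    exact mul_right_cancel₀ hβ.ne' this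
  have key : (fun a : S => c a * Real.exp ((a : ℝ) * β / 4) * q a) = 0 := by
    let e := S.equivFin
    have := Matrix.eq_zero_of_forall_pow_sum_mul_pow_eq_zero (R := ℝ) (n := S.card)
      (f := fun i => q (e.symm i))
      (v := fun i => c (e.symm i) * Real.exp ((e.symm i : ℝ) * β / 4) * q (e.symm i))
      (fun i j hij => e.symm.injective (Subtype.ext (hq hij))) (fun k => by
        have hk := h ((k : ℕ) + 1) (by positivity)
        rw [← hk, ← Finset.sum_coe_sort S, ← e.symm.sum_comp]
        refine Finset.sum_congr rfl fun i _ => ?_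
        simp only [q, sechFeature]
        rw [← Real.exp_nat_mul, mul_assoc, mul_assoc, ← Real.exp_add]
        ring_nf)
    funext a
    have h2 := congrFun this (e a)
    simpa using h2
  intro a ha
  have h1 := congrFun key ⟨a, ha⟩
  have h2 : Real.exp (a * β / 4) * q a ≠ 0 := by positivity
  rw [mul_assoc] at h1
  exact (mul_eq_zero.mp h1).resolve_right h2

/-- Strict positivity of the kernel at distinct points: its quadratic form is the integral of the
square of a combination of feature functions. -/
theorem eq_zero_of_sum_sechKernel_eq_zero {β : ℝ} (hβ : 0 < β) (S : Finset ℝ) (c : ℝ → ℝ)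
    (h : ∑ a ∈ S, ∑ b ∈ S, sechKernel β a b * (c a * c b) = 0) : ∀ a ∈ S, c a = 0 := by
  have hsq : ∀ r, ∑ a ∈ S, ∑ b ∈ S, sechFeature β a r * sechFeature β b r * (c a * c b) =
      (∑ a ∈ S, c a * sechFeature β a r) ^ 2 := by
    intro r
    rw [sq, Finset.sum_mul_sum]
    exact Finset.sum_congr rfl fun a _ => Finset.sum_congr rfl fun b _ => by ring
  have hint : IntegrableOn (fun r => (∑ a ∈ S, c a * sechFeature β a r) ^ 2) (Set.Ioi 0) := by
    simp_rw [← hsq]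
    exact integrable_finsetSum _ fun a _ => integrable_finsetSum _ fun b _ =>
      (integrableOn_sechFeature_mul β a b).mul_const _
  rw [sum_sechKernel_mul] at h
  simp_rw [hsq] at h
  have h0 := (setIntegral_eq_zero_iff_of_nonneg_ae (ae_of_all _ fun r => sq_nonneg _) hint).mp h
  have hcont : Continuous fun r => (∑ a ∈ S, c a * sechFeature β a r) ^ 2 := by
    unfold sechFeature; fun_prop
  have h1 := Measure.eqOn_open_of_ae_eq h0 isOpen_Ioi hcont.continuousOn continuousOn_const
  refine eq_zero_of_sum_sechFeature_eq_zero hβ S c fun r hr => ?_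
  exact pow_eq_zero_iff two_ne_zero |>.mp (h1 hr)

/-- Complex form of the strict positivity of the kernel. -/
theorem eq_zero_of_sum_sechKernel_re_nonpos {β : ℝ} (hβ : 0 < β) (S : Finset ℝ) (c : ℝ → ℂ)
    (h : ∑ a ∈ S, ∑ b ∈ S, sechKernel β a b * ((starRingEnd ℂ) (c a) * c b).re ≤ 0) :
    ∀ a ∈ S, c a = 0 := by
  have hnn : ∀ d : ℝ → ℝ, 0 ≤ ∑ a ∈ S, ∑ b ∈ S, sechKernel β a b * (d a * d b) := by
    intro d
    refine sum_sechKernel_mul_nonneg β S _ fun t => ?_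
    have : ∑ a ∈ S, ∑ b ∈ S, t a * t b * (d a * d b) = (∑ a ∈ S, t a * d a) ^ 2 := by
      rw [sq, Finset.sum_mul_sum]
      exact Finset.sum_congr rfl fun a _ => Finset.sum_congr rfl fun b _ => by ring
    rw [this]; positivity
  have hsplit : ∑ a ∈ S, ∑ b ∈ S, sechKernel β a b * ((starRingEnd ℂ) (c a) * c b).re =
      ∑ a ∈ S, ∑ b ∈ S, sechKernel β a b * ((c a).re * (c b).re) +
      ∑ a ∈ S, ∑ b ∈ S, sechKernel β a b * ((c a).im * (c b).im) := by
    simp_rw [← Finset.sum_add_distrib]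
    refine Finset.sum_congr rfl fun a _ => Finset.sum_congr rfl fun b _ => ?_
    simp [Complex.mul_re]; ring
  have h1 := hnn fun a => (c a).re
  have h2 := hnn fun a => (c a).im
  rw [hsplit] at h
  intro a ha
  exact Complex.ext
    (eq_zero_of_sum_sechKernel_eq_zero hβ S (fun a => (c a).re) (by linarith) a ha)
    (eq_zero_of_sum_sechKernel_eq_zero hβ S (fun a => (c a).im) (by linarith) a ha)

/-! ### Hilbert–Schmidt operators -/

section HilbertSchmidt

variable {X : Type*} [NormedAddCommGroup X] [InnerProductSpace ℂ X] [CompleteSpace X]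
  {ι κ : Type*}

omit [CompleteSpace X] in
theorem enorm_inner_symm (u v : X) : ‖⟪u, v⟫_ℂ‖ₑ = ‖⟪v, u⟫_ℂ‖ₑ := by
  rw [← ofReal_norm, norm_inner_symm, ofReal_norm]

omit [CompleteSpace X] in
theorem tsum_enorm_inner_sq (g : HilbertBasis ι ℂ X) (v : X) :
    ∑' i, ‖⟪g i, v⟫_ℂ‖ₑ ^ 2 = ‖v‖ₑ ^ 2 := by
  have h := lp.hasSum_norm (p := 2) (by norm_num) (g.repr v)
  have h' : HasSum (fun i => ‖⟪g i, v⟫_ℂ‖ ^ 2) (‖v‖ ^ 2) := by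
    simpa [g.repr_apply_apply] using h
  have h2 := ENNReal.ofReal_tsum_of_nonneg (fun i => by positivity) h'.summable
  rw [h'.tsum_eq] at h2
  rw [← ofReal_norm v, ← ENNReal.ofReal_pow (norm_nonneg v), h2]
  exact tsum_congr fun i => by rw [← ofReal_norm, ENNReal.ofReal_pow (norm_nonneg _)]

/-- Both sides are `∑ᵢⱼ |⟪gᵢ, x bⱼ⟫|²`, which makes the Hilbert–Schmidt norm independent of the
basis. -/
theorem tsum_enorm_apply_sq (g : HilbertBasis ι ℂ X) (b : HilbertBasis κ ℂ X) (x : X →L[ℂ] X) :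
    ∑' i, ‖x (b i)‖ₑ ^ 2 = ∑' i, ‖(ContinuousLinearMap.adjoint x) (g i)‖ₑ ^ 2 := by
  simp_rw [← tsum_enorm_inner_sq g (x (b _)), ← tsum_enorm_inner_sq b (_)]
  rw [ENNReal.tsum_comm]
  refine tsum_congr fun i => tsum_congr fun j => ?_
  rw [ContinuousLinearMap.adjoint_inner_right, enorm_inner_symm]

variable (X) in
/-- The Hilbert basis indexed by `onbSet X`. -/
def onb : HilbertBasis (onbSet X) ℂ X := (exists_hilbertBasis ℂ X).choose_spec.choose

theorem onb_apply (i : onbSet X) : onb X i = i :=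
  congrFun (exists_hilbertBasis ℂ X).choose_spec.choose_spec i

/-- The Hilbert–Schmidt norm may be computed from the adjoint in any Hilbert basis. -/
theorem hsNormSq_eq_tsum_adjoint (g : HilbertBasis ι ℂ X) (x : X →L[ℂ] X) :
    hsNormSq x = ∑' i, ‖(ContinuousLinearMap.adjoint x) (g i)‖ₑ ^ 2 := by
  rw [← tsum_enorm_apply_sq g (onb X), hsNormSq]
  simp_rw [onb_apply]

theorem enorm_inner_sq_le_hsNormSq (g : HilbertBasis ι ℂ X) (x : X →L[ℂ] X) (j i : ι) :
    ‖⟪g j, x (g i)⟫_ℂ‖ₑ ^ 2 ≤ hsNormSq x := by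
  rw [hsNormSq_eq_tsum_adjoint g, ← ContinuousLinearMap.adjoint_inner_left]
  refine le_trans ?_ (ENNReal.le_tsum j)
  rw [← tsum_enorm_inner_sq g]
  rw [enorm_inner_symm]
  exact ENNReal.le_tsum i

theorem isHilbertSchmidt_iff_memℓp (x : X →L[ℂ] X) :
    IsHilbertSchmidt x ↔ Memℓp (fun b : onbSet X => x b) 2 := by
  rw [IsHilbertSchmidt, memℓp_gen_iff (by norm_num), hsNormSq]
  have : ∀ b : onbSet X, ‖x b‖ₑ ^ 2 = ((‖x b‖₊ ^ 2 : NNReal) : ℝ≥0∞) := fun b => by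
    simp [enorm_eq_nnnorm]
  simp_rw [this]
  rw [lt_top_iff_ne_top, ENNReal.tsum_coe_ne_top_iff_summable, ← NNReal.summable_coe]
  simp

variable (X) in
/-- The Hilbert–Schmidt class as a space of operators. -/
def hsClass : Submodule ℂ (X →L[ℂ] X) where
  carrier := {x | IsHilbertSchmidt x}
  zero_mem' := by
    rw [Set.mem_ofPred_eq, isHilbertSchmidt_iff_memℓp]
    exact zero_memℓp
  add_mem' := by
    intro x y hx hy
    rw [Set.mem_ofPred_eq, isHilbertSchmidt_iff_memℓp] at *
    exact hx.add hy
  smul_mem' := by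
    intro c x hx
    rw [Set.mem_ofPred_eq, isHilbertSchmidt_iff_memℓp] at *
    exact hx.const_smul c

theorem mem_hsClass {x : X →L[ℂ] X} : x ∈ hsClass X ↔ IsHilbertSchmidt x := Iff.rfl

variable (X) in
/-- The embedding of the Hilbert–Schmidt class into the Hilbert space `ℓ²(X)` of images of an
orthonormal basis. -/
def hsToLp : hsClass X →ₗ[ℂ] lp (fun _ : onbSet X => X) 2 where
  toFun x := ⟨fun b => x.1 b, (isHilbertSchmidt_iff_memℓp x.1).mp x.2⟩
  map_add' _ _ := rfl
  map_smul' _ _ := rfl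

theorem hsInner_eq_inner (x y : hsClass X) : hsInner x.1 y.1 = ⟪hsToLp X x, hsToLp X y⟫_ℂ := by
  rw [lp.inner_eq_tsum]; rfl

theorem enorm_hsToLp_sq (x : hsClass X) : ‖hsToLp X x‖ₑ ^ 2 = hsNormSq x.1 := by
  have h := lp.hasSum_norm (p := 2) (by norm_num) (hsToLp X x)
  have h' : HasSum (fun b : onbSet X => ‖x.1 b‖ ^ 2) (‖hsToLp X x‖ ^ 2) := by
    have h0 : HasSum (fun b : onbSet X => ‖(hsToLp X x) b‖ ^ 2) (‖hsToLp X x‖ ^ 2) := by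
      simpa using h
    exact h0
  have h2 := ENNReal.ofReal_tsum_of_nonneg (fun i => by positivity) h'.summable
  rw [h'.tsum_eq] at h2
  rw [← ofReal_norm, ← ENNReal.ofReal_pow (norm_nonneg _), h2]
  exact tsum_congr fun i => by rw [← ofReal_norm, ENNReal.ofReal_pow (norm_nonneg _)]

theorem norm_inner_le_norm_hsToLp (g : HilbertBasis ι ℂ X) (x : hsClass X) (j i : ι) :
    ‖⟪g j, x.1 (g i)⟫_ℂ‖ ≤ ‖hsToLp X x‖ := by
  have h := enorm_inner_sq_le_hsNormSq g x.1 j i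
  rw [← enorm_hsToLp_sq] at h
  have h2 := (ENNReal.pow_le_pow_left_iff two_ne_zero).mp h
  exact enorm_le_iff_norm_le.mp h2

theorem rankOne_mem_hsClass (u v : X) : InnerProductSpace.rankOne ℂ u v ∈ hsClass X := by
  rw [mem_hsClass, IsHilbertSchmidt, hsNormSq]
  have : ∀ b : onbSet X, ‖InnerProductSpace.rankOne ℂ u v (b : X)‖ₑ ^ 2 =
      ‖u‖ₑ ^ 2 * ‖⟪onb X b, v⟫_ℂ‖ₑ ^ 2 := by
    intro b
    rw [InnerProductSpace.rankOne_apply, enorm_smul, onb_apply, enorm_inner_symm, mul_pow,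
      mul_comm]
  simp_rw [this]
  rw [ENNReal.tsum_mul_left, tsum_enorm_inner_sq]
  exact ENNReal.mul_lt_top (by simp) (by simp)

/-- Convergence in Hilbert–Schmidt norm implies convergence of matrix elements. -/
theorem tendsto_inner_of_tendsto_hsNormSq (g : HilbertBasis ι ℂ X) {z : ℕ → X →L[ℂ] X}
    {x : X →L[ℂ] X} (h : Tendsto (fun n => hsNormSq (z n - x)) atTop (𝓝 0)) (j i : ι) :
    Tendsto (fun n => ⟪g j, z n (g i)⟫_ℂ) atTop (𝓝 ⟪g j, x (g i)⟫_ℂ) := by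
  rw [tendsto_iff_norm_sub_tendsto_zero]
  have h1 : Tendsto (fun n => ‖⟪g j, (z n - x) (g i)⟫_ℂ‖ₑ ^ 2) atTop (𝓝 0) :=
    tendsto_of_tendsto_of_tendsto_of_le_of_le tendsto_const_nhds h (fun _ => zero_le)
      fun n => enorm_inner_sq_le_hsNormSq g _ j i
  have h2 : Tendsto (fun n => ‖⟪g j, (z n - x) (g i)⟫_ℂ‖ ^ 2) atTop (𝓝 0) := by
    have := (ENNReal.tendsto_toReal ENNReal.zero_ne_top).comp h1
    simpa [Function.comp_def, ENNReal.toReal_pow] using this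
  have h3 := h2.sqrt
  simpa [inner_sub_right, Real.sqrt_sq] using h3

/-- The bilinear expression `∑ k(a,b) ⟪y_a, y_b⟫` of Hilbert–Schmidt operators dominates the same
expression of any matrix element, by the Schur product theorem. -/
theorem sum_sechKernel_inner_le (g : HilbertBasis ι ℂ X) (β : ℝ) (S : Finset ℝ)
    (y : ℝ → X →L[ℂ] X) (hy : ∀ a, y a ∈ hsClass X) (j i : ι) :
    ∑ a ∈ S, ∑ b ∈ S, sechKernel β a b *
        ((starRingEnd ℂ) ⟪g j, y a (g i)⟫_ℂ * ⟪g j, y b (g i)⟫_ℂ).re ≤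
      ∑ a ∈ S, ∑ b ∈ S, sechKernel β a b * (hsInner (y a) (y b)).re := by
  rw [← sub_nonneg]
  simp_rw [← Finset.sum_sub_distrib, ← mul_sub]
  refine sum_sechKernel_mul_nonneg β S _ fun t => ?_
  let Y : hsClass X := ∑ a ∈ S, (t a : ℂ) • ⟨y a, hy a⟩
  have h := norm_inner_le_norm_hsToLp g Y j i
  have h1 : ‖hsToLp X Y‖ ^ 2 = ∑ a ∈ S, ∑ b ∈ S, t a * t b * (hsInner (y a) (y b)).re := by
    have hY : hsToLp X Y = ∑ a ∈ S, (t a : ℂ) • hsToLp X ⟨y a, hy a⟩ := by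
      simp only [Y, map_sum, map_smul]
    rw [← inner_self_eq_norm_sq (𝕜 := ℂ), hY, sum_inner, map_sum]
    refine Finset.sum_congr rfl fun a _ => ?_
    rw [inner_sum, map_sum]
    refine Finset.sum_congr rfl fun b _ => ?_
    rw [inner_smul_left, inner_smul_right, ← hsInner_eq_inner, Complex.conj_ofReal, ← mul_assoc,
      ← Complex.ofReal_mul, RCLike.re_to_complex, Complex.re_ofReal_mul]
  have h2 : ‖⟪g j, Y.1 (g i)⟫_ℂ‖ ^ 2 = ∑ a ∈ S, ∑ b ∈ S, t a * t b *
      ((starRingEnd ℂ) ⟪g j, y a (g i)⟫_ℂ * ⟪g j, y b (g i)⟫_ℂ).re := by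
    have : ⟪g j, Y.1 (g i)⟫_ℂ = ∑ a ∈ S, (t a : ℂ) * ⟪g j, y a (g i)⟫_ℂ := by
      simp [Y]
    have h3 : ‖⟪g j, Y.1 (g i)⟫_ℂ‖ ^ 2 =
        ((starRingEnd ℂ) ⟪g j, Y.1 (g i)⟫_ℂ * ⟪g j, Y.1 (g i)⟫_ℂ).re := by
      rw [mul_comm, Complex.mul_conj, Complex.ofReal_re, Complex.normSq_eq_norm_sq]
    rw [h3, this, map_sum, Finset.sum_mul_sum, Complex.re_sum]
    refine Finset.sum_congr rfl fun a _ => ?_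
    rw [Complex.re_sum]
    refine Finset.sum_congr rfl fun b _ => ?_
    rw [map_mul, Complex.conj_ofReal, mul_mul_mul_comm, ← Complex.ofReal_mul,
      Complex.re_ofReal_mul]
  simp_rw [mul_sub, Finset.sum_sub_distrib]
  rw [← h1, ← h2, sub_nonneg]
  exact pow_le_pow_left₀ (norm_nonneg _) h 2

end HilbertSchmidt

/-! ### Operators with a Gibbs-summable eigenbasis -/

section Eigenbasis

variable {X : Type*} [NormedAddCommGroup X] [InnerProductSpace ℂ X] {ι : Type*}

theorem ext_inner_hilbertBasis (g : HilbertBasis ι ℂ X) {u v : X}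
    (h : ∀ i, ⟪g i, u⟫_ℂ = ⟪g i, v⟫_ℂ) : u = v := by
  refine g.repr.injective (lp.ext (funext fun i => ?_))
  simpa [g.repr_apply_apply] using h i

/-- A Hilbert basis of eigenvectors `g i` of `H` with energies `E i`, for which `H` is symmetric
against the basis vectors and all partition functions `∑ e^{-sE}` are finite. -/
structure IsGibbsEigenbasis (H : X →ₗ.[ℂ] X) (g : HilbertBasis ι ℂ X) (E : ι → ℝ) : Prop where
  eigen : ∀ i, ∃ h : g i ∈ H.domain, H ⟨g i, h⟩ = (E i : ℂ) • g i
  symm : ∀ i (v : H.domain), ⟪g i, H v⟫_ℂ = (E i : ℂ) * ⟪g i, (v : X)⟫_ℂ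
  gibbs : ∀ s : ℝ, 0 < s → Summable fun i => Real.exp (-(s * E i))

/-- The algebraic span of a Hilbert basis. -/
def finiteSpan (g : HilbertBasis ι ℂ X) : Submodule ℂ X := Submodule.span ℂ (Set.range g)

theorem basis_mem_finiteSpan (g : HilbertBasis ι ℂ X) (i : ι) : g i ∈ finiteSpan g :=
  Submodule.subset_span ⟨i, rfl⟩

theorem inner_hilbertBasis (g : HilbertBasis ι ℂ X) [DecidableEq ι] (i j : ι) :
    ⟪g i, g j⟫_ℂ = if i = j then 1 else 0 :=
  orthonormal_iff_ite.mp g.orthonormal i j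

theorem eq_sum_inner_smul (g : HilbertBasis ι ℂ X) {v : X} {S : Finset ι}
    (h : ∀ i ∉ S, ⟪g i, v⟫_ℂ = 0) : v = ∑ i ∈ S, ⟪g i, v⟫_ℂ • g i := by
  classical
  refine ext_inner_hilbertBasis g fun j => ?_
  simp only [inner_sum, inner_smul_right, inner_hilbertBasis, mul_ite, mul_one, mul_zero,
    Finset.sum_ite_eq]
  split_ifs with hj
  · rfl
  · exact h j hj

theorem mem_finiteSpan_iff (g : HilbertBasis ι ℂ X) {v : X} :
    v ∈ finiteSpan g ↔ {i | ⟪g i, v⟫_ℂ ≠ 0}.Finite := by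
  classical
  constructor
  · intro hv
    induction hv using Submodule.span_induction with
    | mem x hx =>
      obtain ⟨j, rfl⟩ := hx
      refine (Set.finite_singleton j).subset fun i hi => ?_
      by_contra hij
      exact hi (by rw [inner_hilbertBasis, if_neg (by simpa using hij)])
    | zero => simp
    | add x y _ _ hx hy =>
      refine (hx.union hy).subset fun i hi => ?_
      by_contra hij
      simp only [Set.mem_union, Set.mem_ofPred_eq, not_or, not_not] at hij
      exact hi (by rw [inner_add_right, hij.1, hij.2, add_zero])
    | smul c x _ hx =>
      refine hx.subset fun i hi => ?_
      intro h
      exact hi (by rw [inner_smul_right, h, mul_zero])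
  · intro h
    rw [eq_sum_inner_smul g (v := v) (S := h.toFinset) fun i hi => by simpa using hi]
    exact Submodule.sum_mem _ fun i _ => Submodule.smul_mem _ _ (basis_mem_finiteSpan g i)

namespace IsGibbsEigenbasis

variable {H : X →ₗ.[ℂ] X} {g : HilbertBasis ι ℂ X} {E : ι → ℝ}

theorem finite_level (hH : IsGibbsEigenbasis H g E) (t : ℝ) : {i | E i = t}.Finite := by
  have h := (hH.gibbs 1 one_pos).tendsto_cofinite_zero
  have h1 := h.eventually (gt_mem_nhds (Real.exp_pos (-(1 * t))))
  rw [Filter.eventually_cofinite] at h1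
  refine h1.subset fun i hi => ?_
  rw [Set.mem_ofPred_eq] at hi ⊢
  rw [hi]
  exact lt_irrefl _

theorem basis_mem_eigenspace (hH : IsGibbsEigenbasis H g E) (i : ι) :
    g i ∈ eigenspace H (E i) := hH.eigen i

/-- An eigenvector of `H` is supported on the basis vectors of the same energy, so the eigenspaces
of `H` are exactly those spanned by the basis. -/
theorem mem_eigenspace_iff (hH : IsGibbsEigenbasis H g E) {t : ℝ} {v : X} :
    v ∈ eigenspace H t ↔ ∀ i, E i ≠ t → ⟪g i, v⟫_ℂ = 0 := by
  classical
  constructor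
  · rintro ⟨hv, hHv⟩ i hi
    have h := hH.symm i ⟨v, hv⟩
    rw [hHv, inner_smul_right] at h
    have h2 : ((t : ℂ) - E i) * ⟪g i, v⟫_ℂ = 0 := by rw [sub_mul, h, sub_self]
    refine (mul_eq_zero.mp h2).resolve_left fun h3 => hi ?_
    exact_mod_cast (sub_eq_zero.mp h3).symm
  · intro h
    rw [eq_sum_inner_smul g (S := (hH.finite_level t).toFinset) fun i hi =>
      h i (by simpa using hi)]
    refine Submodule.sum_mem _ fun i hi => Submodule.smul_mem _ _ ?_
    rw [Set.Finite.mem_toFinset, Set.mem_ofPred_eq] at hi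
    exact hi ▸ hH.basis_mem_eigenspace i

theorem eigenspace_le_finiteSpan (hH : IsGibbsEigenbasis H g E) (t : ℝ) :
    eigenspace H t ≤ finiteSpan g := fun v hv => by
  rw [mem_finiteSpan_iff]
  refine (hH.finite_level t).subset fun i hi => ?_
  by_contra h
  exact hi (hH.mem_eigenspace_iff.mp hv i h)

theorem isClosed_eigenspace (hH : IsGibbsEigenbasis H g E) (t : ℝ) :
    IsClosed (eigenspace H t : Set X) := by
  have : (eigenspace H t : Set X) = ⋂ i, ⋂ _ : E i ≠ t, {v | ⟪g i, v⟫_ℂ = 0} := by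
    ext v
    simp [hH.mem_eigenspace_iff]
  rw [this]
  exact isClosed_iInter fun i => isClosed_iInter fun _ =>
    isClosed_eq (continuous_const.inner continuous_id) continuous_const

theorem finiteDimensional_eigenspace (hH : IsGibbsEigenbasis H g E) (t : ℝ) :
    FiniteDimensional ℂ (eigenspace H t) := by
  have hle : eigenspace H t ≤ Submodule.span ℂ (g '' {i | E i = t}) := by
    intro v hv
    rw [eq_sum_inner_smul g (S := (hH.finite_level t).toFinset) fun i hi =>
      hH.mem_eigenspace_iff.mp hv i (by simpa using hi)]
    refine Submodule.sum_mem _ fun i hi =>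
      Submodule.smul_mem _ _ (Submodule.subset_span ⟨i, ?_, rfl⟩)
    simpa using hi
  have := FiniteDimensional.span_of_finite ℂ ((hH.finite_level t).image g)
  exact Submodule.finiteDimensional_of_le hle

theorem energy_mem_energies (hH : IsGibbsEigenbasis H g E) (i : ι) : E i ∈ energies H := by
  intro h
  have h1 := hH.basis_mem_eigenspace i
  rw [h, Submodule.mem_bot] at h1
  exact (g.orthonormal.ne_zero i) h1

variable [CompleteSpace X]

theorem eigenProj_mem (hH : IsGibbsEigenbasis H g E) (t : ℝ) (v : X) :
    eigenProj H t v ∈ eigenspace H t := by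
  exact (hH.isClosed_eigenspace t).submodule_topologicalClosure_eq.le
    (Submodule.starProjection_apply_mem (eigenspace H t).topologicalClosure v)

theorem inner_eigenProj (hH : IsGibbsEigenbasis H g E) (t : ℝ) (i : ι) (v : X) :
    ⟪g i, eigenProj H t v⟫_ℂ = if E i = t then ⟪g i, v⟫_ℂ else 0 := by
  split_ifs with h
  · have h1 : eigenProj H t (g i) = g i := by
      rw [eigenProj, Submodule.starProjection_eq_self_iff]
      exact Submodule.le_topologicalClosure _ (h ▸ hH.basis_mem_eigenspace i)
    conv_rhs => rw [← h1]
    exact (Submodule.inner_starProjection_left_eq_right _ _ _).symm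
  · exact hH.mem_eigenspace_iff.mp (hH.eigenProj_mem t v) i h

theorem inner_eigenProj_left (t : ℝ) (u v : X) :
    ⟪eigenProj H t u, v⟫_ℂ = ⟪u, eigenProj H t v⟫_ℂ :=
  Submodule.inner_starProjection_left_eq_right _ _ _

theorem eigenProj_eq_ite (hH : IsGibbsEigenbasis H g E) {t : ℝ} {v : X} (hv : v ∈ eigenspace H t)
    (t' : ℝ) : eigenProj H t' v = if t' = t then v else 0 := by
  refine ext_inner_hilbertBasis g fun i => ?_
  rw [hH.inner_eigenProj]
  by_cases h : E i = t
  · subst h; simp only [eq_comm]; split_ifs <;> simp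
  · have := hH.mem_eigenspace_iff.mp hv i h
    split_ifs <;> simp [this]

theorem eigenProj_eq_zero_of_notMem (hH : IsGibbsEigenbasis H g E) {t : ℝ} (ht : t ∉ energies H)
    (v : X) : eigenProj H t v = 0 := by
  have h : eigenspace H t = ⊥ := not_not.mp ht
  have := hH.eigenProj_mem t v
  rwa [h, Submodule.mem_bot] at this

/-- A vector of finite energy has finitely many energy components. -/
theorem finite_eigenProj_ne_zero (hH : IsGibbsEigenbasis H g E) {v : X} (hv : v ∈ finiteSpan g) :
    {t | eigenProj H t v ≠ 0}.Finite := by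
  refine ((mem_finiteSpan_iff g).mp hv |>.image E).subset fun t ht => ?_
  by_contra h
  refine ht (ext_inner_hilbertBasis g fun i => ?_)
  rw [hH.inner_eigenProj, inner_zero_right]
  split_ifs with hi
  · by_contra h2
    exact h ⟨i, h2, hi⟩
  · rfl

/-- A vector of finite energy is the sum of its energy components. -/
theorem sum_eigenProj (hH : IsGibbsEigenbasis H g E) {v : X} {S : Finset ℝ}
    (hS : ∀ t, eigenProj H t v ≠ 0 → t ∈ S) : ∑ t ∈ S, eigenProj H t v = v := by
  refine ext_inner_hilbertBasis g fun i => ?_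
  rw [inner_sum]
  simp_rw [hH.inner_eigenProj]
  rw [Finset.sum_ite_eq]
  split_ifs with h
  · rfl
  · have h1 : eigenProj H (E i) v = 0 := by
      by_contra h2; exact h (hS _ h2)
    have h2 := hH.inner_eigenProj (E i) i v
    rw [h1, if_pos rfl, inner_zero_right] at h2
    exact h2

theorem hasSum_energyFiber (hH : IsGibbsEigenbasis H g E) (t : ℝ) (c : ℂ) (v : X) :
    HasSum (fun i : {i // E i = t} => c • ⟪g i, v⟫_ℂ • g i) (c • eigenProj H t v) := by
  have h1 : HasSum (fun i => ⟪g i, eigenProj H t v⟫_ℂ • g i) (eigenProj H t v) := by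
    simpa only [g.repr_apply_apply] using g.hasSum_repr (eigenProj H t v)
  have h2 : Function.support (fun i => ⟪g i, eigenProj H t v⟫_ℂ • g i) ⊆ {i | E i = t} := by
    intro i hi
    by_contra h
    exact hi (by simp only [hH.inner_eigenProj, if_neg (show ¬ E i = t from h), zero_smul])
  have h3 := (hasSum_subtype_iff_of_support_subset h2).mpr h1
  refine (h3.congr_fun fun i => ?_).const_smul c
  rw [Function.comp_apply, hH.inner_eigenProj, if_pos (show E i = t from i.2)]

/-- Absolutely summable nonnegative eigenvalues define a bounded diagonal operator. -/
theorem exists_diagonal (g : HilbertBasis ι ℂ X) {c : ι → ℝ} (hc : Summable c)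
    (hpos : ∀ i, 0 ≤ c i) :
    ∃ G : X →L[ℂ] X, ∀ v, HasSum (fun i => (c i : ℂ) • ⟪g i, v⟫_ℂ • g i) (G v) := by
  let D : ι → X →L[ℂ] X := fun i => (c i : ℂ) • InnerProductSpace.rankOne ℂ (g i) (g i)
  have hD : Summable D := by
    refine Summable.of_norm_bounded hc fun i => ?_
    rw [norm_smul, InnerProductSpace.norm_rankOne, g.orthonormal.1 i, Complex.norm_real,
      Real.norm_eq_abs, abs_of_nonneg (hpos i)]
    simp
  refine ⟨∑' i, D i, fun v => ?_⟩
  have h := hD.hasSum.map (ContinuousLinearMap.apply ℂ X v).toLinearMap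
    (ContinuousLinearMap.apply ℂ X v).continuous
  exact h.congr_fun fun i => rfl

omit [CompleteSpace X] in
theorem inner_diagonal (g : HilbertBasis ι ℂ X) {c : ι → ℂ} {v w : X}
    (h : HasSum (fun i => c i • ⟪g i, v⟫_ℂ • g i) w) (i : ι) :
    ⟪g i, w⟫_ℂ = c i * ⟪g i, v⟫_ℂ := by
  classical
  have h1 := (innerSL ℂ (g i)).hasSum h
  have h2 := hasSum_single (f := fun j => innerSL ℂ (g i) (c j • ⟪g j, v⟫_ℂ • g j)) i
    (fun j hj => by simp [inner_hilbertBasis, hj.symm])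
  have h3 := h1.unique h2
  simpa [inner_smul_right, g.orthonormal.1 i] using h3

/-- The defining sum of `e^{-sH}` over all real energies converges: it is the sum over the
eigenbasis, grouped by energy. -/
theorem exists_hasSum_expNeg (hH : IsGibbsEigenbasis H g E) {s : ℝ} (hs : 0 < s) :
    ∃ G : X →L[ℂ] X, (∀ v, HasSum (fun t : ℝ => (Real.exp (-(s * t)) : ℂ) • eigenProj H t v) (G v))
      ∧ ∀ i v, ⟪g i, G v⟫_ℂ = (Real.exp (-(s * E i)) : ℂ) * ⟪g i, v⟫_ℂ := by
  obtain ⟨G, hG⟩ := exists_diagonal g (hH.gibbs s hs) fun i => (Real.exp_pos _).le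
  refine ⟨G, fun v => ?_, fun i v => inner_diagonal g (hG v) i⟩
  refine ((Equiv.sigmaFiberEquiv E).hasSum_iff.mpr (hG v)).sigma fun t => ?_
  refine (hH.hasSum_energyFiber t (Real.exp (-(s * t)) : ℂ) v).congr_fun ?_
  rintro ⟨i, hi⟩
  subst hi
  rfl

theorem inner_expNeg (hH : IsGibbsEigenbasis H g E) {s : ℝ} (hs : 0 < s) (i : ι) (v : X) :
    ⟪g i, expNeg H s v⟫_ℂ = (Real.exp (-(s * E i)) : ℂ) * ⟪g i, v⟫_ℂ := by
  obtain ⟨G, hG, hG'⟩ := hH.exists_hasSum_expNeg hs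
  have h : ∃ G : X →L[ℂ] X, ∀ v,
      HasSum (fun t : ℝ => (Real.exp (-(s * t)) : ℂ) • eigenProj H t v) (G v) := ⟨G, hG⟩
  rw [expNeg, dif_pos h, (h.choose_spec v).unique (hG v), hG']

theorem expNeg_apply_eigenvector (hH : IsGibbsEigenbasis H g E) {s : ℝ} (hs : 0 < s) {t : ℝ} {v : X}
    (hv : v ∈ eigenspace H t) : expNeg H s v = (Real.exp (-(s * t)) : ℂ) • v := by
  refine ext_inner_hilbertBasis g fun i => ?_
  rw [hH.inner_expNeg hs, inner_smul_right]
  by_cases h : E i = t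
  · rw [h]
  · rw [hH.mem_eigenspace_iff.mp hv i h, mul_zero, mul_zero]

theorem eigenProj_expNeg (hH : IsGibbsEigenbasis H g E) {s : ℝ} (hs : 0 < s) (t : ℝ) (v : X) :
    eigenProj H t (expNeg H s v) = (Real.exp (-(s * t)) : ℂ) • eigenProj H t v := by
  refine ext_inner_hilbertBasis g fun i => ?_
  rw [hH.inner_eigenProj, inner_smul_right, hH.inner_eigenProj, hH.inner_expNeg hs]
  split_ifs with h
  · rw [h]
  · rw [mul_zero]

theorem isHilbertSchmidt_expNeg (hH : IsGibbsEigenbasis H g E) {s : ℝ} (hs : 0 < s) :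
    IsHilbertSchmidt (expNeg H s) := by
  have h1 : ∀ i, (ContinuousLinearMap.adjoint (expNeg H s)) (g i) =
      (Real.exp (-(s * E i)) : ℂ) • g i := by
    intro i
    refine ext_inner_right ℂ fun v => ?_
    rw [ContinuousLinearMap.adjoint_inner_left, hH.inner_expNeg hs, inner_smul_left,
      Complex.conj_ofReal]
  rw [IsHilbertSchmidt, hsNormSq_eq_tsum_adjoint g]
  have h2 : ∀ i, ‖(ContinuousLinearMap.adjoint (expNeg H s)) (g i)‖ₑ ^ 2 =
      ENNReal.ofReal (Real.exp (-((2 * s) * E i))) := by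
    intro i
    rw [h1, ← ofReal_norm, norm_smul, g.orthonormal.1 i, mul_one, Complex.norm_real,
      Real.norm_eq_abs, abs_of_pos (Real.exp_pos _), ← ENNReal.ofReal_pow (Real.exp_pos _).le,
      ← Real.exp_nat_mul]
    congr 2; push_cast; ring
  simp_rw [h2]
  rw [← ENNReal.ofReal_tsum_of_nonneg (fun i => (Real.exp_pos _).le)
    (hH.gibbs (2 * s) (by positivity))]
  exact ENNReal.ofReal_lt_top

end IsGibbsEigenbasis

end Eigenbasis

/-! ### Energy blocks of a jump and the twisted commutators `δ_ν` -/

section Jumps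

variable {X : Type*} [NormedAddCommGroup X] [InnerProductSpace ℂ X] {ι : Type*}

/-- The unbounded operator `A` maps the subspace `F` of its domain into itself by `B`, and `B` has
the formal adjoint `B'` on `F`. -/
structure IsCoreJump (F : Submodule ℂ X) (A : X →ₗ.[ℂ] X) (B B' : F →ₗ[ℂ] F) : Prop where
  ext : ∀ u : F, ∃ h : (u : X) ∈ A.domain, A ⟨u, h⟩ = B u
  adj : ∀ u v : F, ⟪(B' u : X), v⟫_ℂ = ⟪(u : X), B v⟫_ℂ

/-- A basis vector as an element of the algebraic span. -/
def basisVec (g : HilbertBasis ι ℂ X) (i : ι) : finiteSpan g := ⟨g i, basis_mem_finiteSpan g i⟩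

/-- The vectors of a Hilbert basis as an algebraic basis of their span. -/
def coreBasis (g : HilbertBasis ι ℂ X) : Module.Basis ι ℂ (finiteSpan g) :=
  Module.Basis.span g.orthonormal.linearIndependent

theorem coreBasis_apply (g : HilbertBasis ι ℂ X) (i : ι) : coreBasis g i = basisVec g i :=
  Module.Basis.span_apply _ i

variable [CompleteSpace X]

/-- One term of the sum over energies that defines `δ_ν`. -/
def deltaTerm (β : ℝ) (H A : X →ₗ.[ℂ] X) (ν t : ℝ) : (X →L[ℂ] X) →ₗ[ℂ] (X →L[ℂ] X) where
  toFun x := (Real.exp (-(β * ν / 4)) : ℂ) • (energyBlock H A (t + ν) t ∘L x)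
    - (Real.exp (β * ν / 4) : ℂ) • (x ∘L energyBlock H A (t + ν) t)
  map_add' x y := by
    rw [ContinuousLinearMap.comp_add, ContinuousLinearMap.add_comp, smul_add, smul_add]; abel
  map_smul' c x := by
    rw [ContinuousLinearMap.comp_smul, ContinuousLinearMap.smul_comp, smul_comm _ c,
      smul_comm _ c, ← smul_sub, RingHom.id_apply]

theorem delta_eq_tsum (β : ℝ) (H A : X →ₗ.[ℂ] X) (ν : ℝ) (x : X →L[ℂ] X) :
    delta β H A ν x = ∑' t, deltaTerm β H A ν t x := rfl

namespace IsGibbsEigenbasis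

variable {H A : X →ₗ.[ℂ] X} {g : HilbertBasis ι ℂ X} {E : ι → ℝ}
  {B B' : finiteSpan g →ₗ[ℂ] finiteSpan g}

/-- The energy component of a vector, as an element of the algebraic span. -/
def energyPart (hH : IsGibbsEigenbasis H g E) (t : ℝ) (v : X) : finiteSpan g :=
  ⟨eigenProj H t v, hH.eigenspace_le_finiteSpan t (hH.eigenProj_mem t v)⟩

theorem energyPart_eq_ite (hH : IsGibbsEigenbasis H g E) {t : ℝ} (v : finiteSpan g)
    (hv : (v : X) ∈ eigenspace H t) (t' : ℝ) : hH.energyPart t' v = if t' = t then v else 0 := by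
  refine Subtype.ext ?_
  have : (hH.energyPart t' v : X) = eigenProj H t' v := rfl
  rw [this, hH.eigenProj_eq_ite hv]
  split_ifs <;> rfl

/-- The bounded operator in the definition of `energyBlock` exists because the eigenspaces are
finite-dimensional, and it acts as expected. -/
theorem energyBlock_apply (hH : IsGibbsEigenbasis H g E) (hA : IsCoreJump (finiteSpan g) A B B')
    (t' t : ℝ) (v : X) :
    energyBlock H A t' t v = eigenProj H t' (B (hH.energyPart t v)) := by
  have := hH.finiteDimensional_eigenspace t
  let L : eigenspace H t →ₗ[ℂ] X := (finiteSpan g).subtype ∘ₗ B ∘ₗ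
    Submodule.inclusion (hH.eigenspace_le_finiteSpan t)
  let T : X →L[ℂ] X := eigenProj H t' ∘L L.toContinuousLinearMap ∘L
    (eigenProj H t).codRestrict (eigenspace H t) (hH.eigenProj_mem t)
  have h : ∃ T : X →L[ℂ] X, ∀ v, ∃ hv : eigenProj H t v ∈ A.domain,
      T v = eigenProj H t' (A ⟨eigenProj H t v, hv⟩) := by
    refine ⟨T, fun v => ?_⟩
    obtain ⟨h1, h2⟩ := hA.ext (hH.energyPart t v)
    exact ⟨h1, (congrArg (eigenProj H t') h2).symm⟩
  rw [energyBlock, dif_pos h]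
  obtain ⟨h1, h2⟩ := h.choose_spec v
  obtain ⟨_, h3⟩ := hA.ext (hH.energyPart t v)
  rw [h2]
  exact congrArg (eigenProj H t') h3

theorem inner_energyBlock (hH : IsGibbsEigenbasis H g E)
    (hA : IsCoreJump (finiteSpan g) A B B') (t' t : ℝ) (u v : X) :
    ⟪u, energyBlock H A t' t v⟫_ℂ = ⟪eigenProj H t (B' (hH.energyPart t' u)), v⟫_ℂ := by
  rw [hH.energyBlock_apply hA, ← inner_eigenProj_left t' u, inner_eigenProj_left t _ v]
  exact (hA.adj (hH.energyPart t' u) (hH.energyPart t v)).symm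

/-- `δ_ν` annihilates the square root of the Gibbs state, term by term. -/
theorem deltaTerm_expNeg (hH : IsGibbsEigenbasis H g E)
    (hA : IsCoreJump (finiteSpan g) A B B') {β : ℝ} (hβ : 0 < β) (ν t : ℝ) :
    deltaTerm β H A ν t (expNeg H (β / 2)) = 0 := by
  have hβ2 : 0 < β / 2 := by positivity
  ext v
  have h1 : hH.energyPart t (expNeg H (β / 2) v) =
      (Real.exp (-(β / 2 * t)) : ℂ) • hH.energyPart t v :=
    Subtype.ext (hH.eigenProj_expNeg hβ2 t v)
  have h2 : expNeg H (β / 2) (energyBlock H A (t + ν) t v) =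
      (Real.exp (-(β / 2 * (t + ν))) : ℂ) • energyBlock H A (t + ν) t v := by
    refine hH.expNeg_apply_eigenvector hβ2 ?_
    rw [hH.energyBlock_apply hA]
    exact hH.eigenProj_mem _ _
  have h3 : energyBlock H A (t + ν) t (expNeg H (β / 2) v) =
      (Real.exp (-(β / 2 * t)) : ℂ) • energyBlock H A (t + ν) t v := by
    rw [hH.energyBlock_apply hA, hH.energyBlock_apply hA, h1, map_smul, Submodule.coe_smul,
      map_smul]
  change (Real.exp (-(β * ν / 4)) : ℂ) • energyBlock H A (t + ν) t (expNeg H (β / 2) v) -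
    (Real.exp (β * ν / 4) : ℂ) • expNeg H (β / 2) (energyBlock H A (t + ν) t v) = 0
  rw [h2, h3, smul_smul, smul_smul, ← sub_smul, ← Complex.ofReal_mul, ← Complex.ofReal_mul,
    ← Real.exp_add, ← Real.exp_add]
  have : -(β * ν / 4) + -(β / 2 * t) = β * ν / 4 + -(β / 2 * (t + ν)) := by ring
  rw [this, sub_self, zero_smul]

theorem deltaTerm_rankOne (hH : IsGibbsEigenbasis H g E)
    (hA : IsCoreJump (finiteSpan g) A B B') (β ν t : ℝ) (u v : X) :
    deltaTerm β H A ν t (InnerProductSpace.rankOne ℂ u v) =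
      (Real.exp (-(β * ν / 4)) : ℂ) •
        InnerProductSpace.rankOne ℂ (eigenProj H (t + ν) (B (hH.energyPart t u))) v -
      (Real.exp (β * ν / 4) : ℂ) •
        InnerProductSpace.rankOne ℂ u (eigenProj H t (B' (hH.energyPart (t + ν) v))) := by
  ext w
  change (Real.exp (-(β * ν / 4)) : ℂ) • energyBlock H A (t + ν) t (⟪v, w⟫_ℂ • u) -
    (Real.exp (β * ν / 4) : ℂ) • (⟪v, energyBlock H A (t + ν) t w⟫_ℂ • u) = _
  rw [map_smul, hH.energyBlock_apply hA, hH.inner_energyBlock hA]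
  rfl

/-- On the core of the form only finitely many terms of the `δ_ν` are nonzero, and all of them are
Hilbert–Schmidt. -/
theorem deltaTerm_formCore (hH : IsGibbsEigenbasis H g E)
    (hA : IsCoreJump (finiteSpan g) A B B') {β : ℝ} (hβ : 0 < β) {x : X →L[ℂ] X}
    (hx : x ∈ formCore β H) :
    {p : ℝ × ℝ | deltaTerm β H A p.1 p.2 x ≠ 0}.Finite ∧
      ∀ ν t, deltaTerm β H A ν t x ∈ hsClass X := by
  let W : Submodule ℂ (X →L[ℂ] X) :=
    { carrier := {x | {p : ℝ × ℝ | deltaTerm β H A p.1 p.2 x ≠ 0}.Finite ∧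
        ∀ ν t, deltaTerm β H A ν t x ∈ hsClass X}
      zero_mem' := by
        simp
      add_mem' := by
        rintro x y ⟨hx, hx'⟩ ⟨hy, hy'⟩
        refine ⟨(hx.union hy).subset fun p hp => ?_, fun ν t => ?_⟩
        · by_contra h
          simp only [Set.mem_union, Set.mem_ofPred_eq, not_or, not_not] at h
          exact hp (by rw [map_add, h.1, h.2, add_zero])
        · rw [map_add]; exact Submodule.add_mem _ (hx' ν t) (hy' ν t)
      smul_mem' := by
        rintro c x ⟨hx, hx'⟩
        refine ⟨hx.subset fun p hp h => hp (by rw [map_smul, h, smul_zero]), fun ν t => ?_⟩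
        rw [map_smul]; exact Submodule.smul_mem _ _ (hx' ν t) }
  suffices formCore β H ≤ W from this hx
  refine sup_le (Submodule.span_le.mpr ?_) (Submodule.span_le.mpr ?_)
  · rintro _ ⟨t₁, t₂, u, hu, v, hv, rfl⟩
    let u' : finiteSpan g := ⟨u, hH.eigenspace_le_finiteSpan _ hu⟩
    let v' : finiteSpan g := ⟨v, hH.eigenspace_le_finiteSpan _ hv⟩
    refine ⟨?_, fun ν t => ?_⟩
    · refine (((hH.finite_eigenProj_ne_zero (B u').2).image fun s => (s - t₁, t₁)).union
        ((hH.finite_eigenProj_ne_zero (B' v').2).image fun s => (t₂ - s, s))).subset ?_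
      rintro ⟨ν, t⟩ hp
      by_contra h
      simp only [Set.mem_union, not_or, Set.mem_image, not_exists, not_and] at h
      refine hp ?_
      have h1 : eigenProj H (t + ν) (B (hH.energyPart t u)) = 0 := by
        have : hH.energyPart t u = _ := hH.energyPart_eq_ite u' hu t
        rw [this]
        split_ifs with htt
        · by_contra h2
          exact h.1 _ h2 (by simp [htt])
        · simp
      have h2 : eigenProj H t (B' (hH.energyPart (t + ν) v)) = 0 := by
        have : hH.energyPart (t + ν) v = _ := hH.energyPart_eq_ite v' hv (t + ν)
        rw [this]
        split_ifs with htt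
        · by_contra h2
          exact h.2 _ h2 (by simp [← htt])
        · simp
      simp only [hH.deltaTerm_rankOne hA, h1, h2]
      simp
    · rw [hH.deltaTerm_rankOne hA]
      exact Submodule.sub_mem _ (Submodule.smul_mem _ _ (rankOne_mem_hsClass _ _))
        (Submodule.smul_mem _ _ (rankOne_mem_hsClass _ _))
  · rintro _ rfl
    refine ⟨?_, fun ν t => ?_⟩
    · simp [hH.deltaTerm_expNeg hA hβ]
    · rw [hH.deltaTerm_expNeg hA hβ]; exact Submodule.zero_mem _

theorem hasSum_delta (hH : IsGibbsEigenbasis H g E)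
    (hA : IsCoreJump (finiteSpan g) A B B') {β : ℝ} (hβ : 0 < β) {x : X →L[ℂ] X}
    (hx : x ∈ formCore β H) (ν : ℝ) :
    HasSum (fun t => deltaTerm β H A ν t x) (delta β H A ν x) := by
  refine Summable.hasSum (summable_of_hasFiniteSupport ?_)
  refine ((hH.deltaTerm_formCore hA hβ hx).1.image Prod.snd).subset fun t ht => ⟨(ν, t), ht, rfl⟩

theorem delta_mem_hsClass (hH : IsGibbsEigenbasis H g E)
    (hA : IsCoreJump (finiteSpan g) A B B') {β : ℝ} (hβ : 0 < β) {x : X →L[ℂ] X}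
    (hx : x ∈ formCore β H) (ν : ℝ) : delta β H A ν x ∈ hsClass X := by
  have hfin : (Function.support fun t => deltaTerm β H A ν t x).Finite :=
    ((hH.deltaTerm_formCore hA hβ hx).1.image Prod.snd).subset fun t ht => ⟨(ν, t), ht, rfl⟩
  rw [delta_eq_tsum, tsum_eq_sum (s := hfin.toFinset) fun t ht => by simpa using ht]
  exact Submodule.sum_mem _ fun t _ => (hH.deltaTerm_formCore hA hβ hx).2 ν t

theorem finite_delta_ne_zero (hH : IsGibbsEigenbasis H g E)
    (hA : IsCoreJump (finiteSpan g) A B B') {β : ℝ} (hβ : 0 < β) {x : X →L[ℂ] X}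
    (hx : x ∈ formCore β H) : {ν | delta β H A ν x ≠ 0}.Finite := by
  refine ((hH.deltaTerm_formCore hA hβ hx).1.image Prod.fst).subset fun ν hν => ?_
  by_contra h
  refine hν ?_
  rw [delta_eq_tsum]
  convert tsum_zero with t
  by_contra h2
  exact h ⟨(ν, t), h2, rfl⟩

/-- The matrix element of `δ_ν(x)` between eigenvectors, as an expression in finitely many matrix
elements of `x`. -/
def deltaEntry (hH : IsGibbsEigenbasis H g E) (B B' : finiteSpan g →ₗ[ℂ] finiteSpan g) (β ν : ℝ)
    (j i : ι) (x : X →L[ℂ] X) : ℂ :=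
  (Real.exp (-(β * ν / 4)) : ℂ) * ⟪(hH.energyPart (E j - ν) (B' (basisVec g j)) : X), x (g i)⟫_ℂ -
  (Real.exp (β * ν / 4) : ℂ) * ⟪g j, x (hH.energyPart (E i + ν) (B (basisVec g i)))⟫_ℂ

/-- On the core of the form, the matrix elements of `δ_ν(x)` are the expressions `deltaEntry`, which
make sense, and are continuous in Hilbert–Schmidt norm, for every bounded `x`. -/
theorem inner_delta (hH : IsGibbsEigenbasis H g E)
    (hA : IsCoreJump (finiteSpan g) A B B') {β : ℝ} (hβ : 0 < β) {x : X →L[ℂ] X}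
    (hx : x ∈ formCore β H) (ν : ℝ) (j i : ι) :
    ⟪g j, delta β H A ν x (g i)⟫_ℂ = hH.deltaEntry B B' β ν j i x := by
  have h1 := ((hH.hasSum_delta hA hβ hx ν).map
    (ContinuousLinearMap.apply ℂ X (g i)).toLinearMap
    (ContinuousLinearMap.apply ℂ X (g i)).continuous).map
      (innerSL ℂ (g j)).toLinearMap (innerSL ℂ (g j)).continuous
  have h2 : ∀ t, ⟪g j, deltaTerm β H A ν t x (g i)⟫_ℂ =
      (Real.exp (-(β * ν / 4)) : ℂ) *
        ⟪eigenProj H t (B' (hH.energyPart (t + ν) (g j))), x (g i)⟫_ℂ -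
      (Real.exp (β * ν / 4) : ℂ) *
        ⟪g j, x (eigenProj H (t + ν) (B (hH.energyPart t (g i))))⟫_ℂ := by
    intro t
    rw [← hH.energyBlock_apply hA, ← hH.inner_energyBlock hA, ← inner_smul_right,
      ← inner_smul_right, ← inner_sub_right]
    rfl
  have e1 : ∀ t, hH.energyPart t (g j) = if t = E j then basisVec g j else 0 :=
    hH.energyPart_eq_ite (basisVec g j) (hH.basis_mem_eigenspace j)
  have e2 : ∀ t, hH.energyPart t (g i) = if t = E i then basisVec g i else 0 :=
    hH.energyPart_eq_ite (basisVec g i) (hH.basis_mem_eigenspace i)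
  have h3 := (hasSum_single (f := fun t => (Real.exp (-(β * ν / 4)) : ℂ) *
      ⟪eigenProj H t (B' (hH.energyPart (t + ν) (g j))), x (g i)⟫_ℂ) (E j - ν) (fun t ht => by
        have : t + ν ≠ E j := fun h => ht (by linarith)
        simp [e1, this])).sub
    (hasSum_single (f := fun t => (Real.exp (β * ν / 4) : ℂ) *
      ⟪g j, x (eigenProj H (t + ν) (B (hH.energyPart t (g i))))⟫_ℂ) (E i) (fun t ht => by
        simp [e2, ht]))
  refine (h1.unique (h3.congr_fun h2)).trans ?_
  simp only [e1, e2, sub_add_cancel, if_true]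
  rfl

end IsGibbsEigenbasis

end Jumps

/-! ### The kernel of the closed form -/

section Kernel

variable {X : Type*} [NormedAddCommGroup X] [InnerProductSpace ℂ X] [CompleteSpace X]
  {ι α : Type*} [Fintype α]

namespace IsGibbsEigenbasis

variable {H : X →ₗ.[ℂ] X} {g : HilbertBasis ι ℂ X} {E : ι → ℝ}

/-- Finitely many frequencies contribute to a given matrix element, whatever the operator `x`. -/
theorem finite_deltaEntry_ne_zero (hH : IsGibbsEigenbasis H g E)
    (B B' : finiteSpan g →ₗ[ℂ] finiteSpan g) (β : ℝ) (j i : ι) :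
    ∃ S : Finset ℝ, (∀ ν ∉ S, ∀ x, hH.deltaEntry B B' β ν j i x = 0) ∧
      (∀ ν ∉ S, eigenProj H (E j - ν) (B' (basisVec g j)) = 0) ∧
      ∀ ν ∉ S, eigenProj H (E i + ν) (B (basisVec g i)) = 0 := by
  classical
  let S₁ := (hH.finite_eigenProj_ne_zero (B' (basisVec g j)).2).toFinset
  let S₂ := (hH.finite_eigenProj_ne_zero (B (basisVec g i)).2).toFinset
  have h1 : ∀ ν ∉ S₁.image (fun t => E j - t) ∪ S₂.image (fun t => t - E i),
      eigenProj H (E j - ν) (B' (basisVec g j)) = 0 := by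
    intro ν hν
    by_contra h
    refine hν (Finset.mem_union_left _ (Finset.mem_image.mpr ⟨E j - ν, ?_, by ring⟩))
    simpa [S₁] using h
  have h2 : ∀ ν ∉ S₁.image (fun t => E j - t) ∪ S₂.image (fun t => t - E i),
      eigenProj H (E i + ν) (B (basisVec g i)) = 0 := by
    intro ν hν
    by_contra h
    refine hν (Finset.mem_union_right _ (Finset.mem_image.mpr ⟨E i + ν, ?_, by ring⟩))
    simpa [S₂] using h
  refine ⟨_, fun ν hν x => ?_, h1, h2⟩
  simp only [deltaEntry, energyPart, h1 ν hν, h2 ν hν]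
  simp

variable {A : α → X →ₗ.[ℂ] X} {B B' : α → finiteSpan g →ₗ[ℂ] finiteSpan g}

/-- The contribution of one jump to the form is a finite sum. -/
theorem coreForm_eq_sum (hH : IsGibbsEigenbasis H g E)
    (hA : ∀ a, IsCoreJump (finiteSpan g) (A a) (B a) (B' a)) {β : ℝ} (hβ : 0 < β) (f : ℝ → ℂ)
    {x : X →L[ℂ] X} (hx : x ∈ formCore β H) (S₀ : Finset ℝ) :
    ∃ S : Finset ℝ, S₀ ⊆ S ∧ coreForm β f H A x = ∑ a, ∑ μ ∈ S, ∑ ν ∈ S, sechKernel β μ ν *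
      (hsInner (component β f H (A a) x μ) (component β f H (A a) x ν)).re := by
  classical
  let S : Finset ℝ := S₀ ∪ Finset.univ.biUnion fun a =>
    (hH.finite_delta_ne_zero (hA a) hβ hx).toFinset
  have hS : ∀ a, ∀ ν ∉ S, component β f H (A a) x ν = 0 := by
    intro a ν hν
    have h : delta β H (A a) ν x = 0 := by
      by_contra h
      refine hν (Finset.mem_union_right _ (Finset.mem_biUnion.mpr ⟨a, Finset.mem_univ _, ?_⟩))
      simpa using h
    rw [component, h, smul_zero]
  refine ⟨S, Finset.subset_union_left, Finset.sum_congr rfl fun a _ => ?_⟩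
  rw [tsum_eq_sum (s := S ×ˢ S), Finset.sum_product, Complex.re_sum]
  · refine Finset.sum_congr rfl fun μ _ => ?_
    rw [Complex.re_sum]
    refine Finset.sum_congr rfl fun ν _ => ?_
    rw [Complex.re_ofReal_mul, sechKernel]
  · rintro ⟨μ, ν⟩ hμν
    rw [Finset.mem_product, not_and_or] at hμν
    rcases hμν with h | h
    · simp [hS a μ h, hsInner]
    · simp [hS a ν h, hsInner]

omit [Fintype α] in
theorem component_mem_hsClass (hH : IsGibbsEigenbasis H g E)
    (hA : ∀ a, IsCoreJump (finiteSpan g) (A a) (B a) (B' a)) {β : ℝ} (hβ : 0 < β) (f : ℝ → ℂ)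
    {x : X →L[ℂ] X} (hx : x ∈ formCore β H) (a : α) (ν : ℝ) :
    component β f H (A a) x ν ∈ hsClass X :=
  Submodule.smul_mem _ _ (hH.delta_mem_hsClass (hA a) hβ hx ν)

/-- The form dominates the expression built from a single matrix element of the components. -/
theorem sum_deltaEntry_le_coreForm (hH : IsGibbsEigenbasis H g E)
    (hA : ∀ a, IsCoreJump (finiteSpan g) (A a) (B a) (B' a)) {β : ℝ} (hβ : 0 < β) (f : ℝ → ℂ)
    {x : X →L[ℂ] X} (hx : x ∈ formCore β H) (a : α) (j i : ι) {S₀ : Finset ℝ}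
    (hS₀ : ∀ ν ∉ S₀, ∀ x, hH.deltaEntry (B a) (B' a) β ν j i x = 0) :
    ∑ μ ∈ S₀, ∑ ν ∈ S₀, sechKernel β μ ν *
      ((starRingEnd ℂ) (f μ * (Real.exp (β * μ / 4) : ℂ) *
          hH.deltaEntry (B a) (B' a) β μ j i x) *
        (f ν * (Real.exp (β * ν / 4) : ℂ) * hH.deltaEntry (B a) (B' a) β ν j i x)).re ≤
      coreForm β f H A x := by
  obtain ⟨S, hS, hform⟩ := hH.coreForm_eq_sum hA hβ f hx S₀
  have hentry : ∀ b ν, ⟪g j, component β f H (A b) x ν (g i)⟫_ℂ =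
      f ν * (Real.exp (β * ν / 4) : ℂ) * hH.deltaEntry (B b) (B' b) β ν j i x := by
    intro b ν
    rw [← hH.inner_delta (hA b) hβ hx, ← inner_smul_right]
    rfl
  have hle := fun b => sum_sechKernel_inner_le g β S (component β f H (A b) x)
    (hH.component_mem_hsClass hA hβ f hx b) j i
  have hnn : ∀ b, 0 ≤ ∑ μ ∈ S, ∑ ν ∈ S, sechKernel β μ ν *
      (hsInner (component β f H (A b) x μ) (component β f H (A b) x ν)).re := by
    intro b
    refine le_trans ?_ (hle b)
    refine sum_sechKernel_mul_nonneg β S _ fun t => ?_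
    set c : ℝ → ℂ := fun ν => ⟪g j, component β f H (A b) x ν (g i)⟫_ℂ with hc
    have : ∑ μ ∈ S, ∑ ν ∈ S, t μ * t ν * ((starRingEnd ℂ) (c μ) * c ν).re =
        Complex.normSq (∑ μ ∈ S, (t μ : ℂ) * c μ) := by
      rw [← Complex.ofReal_re (Complex.normSq _), ← Complex.mul_conj, mul_comm, map_sum,
        Finset.sum_mul_sum, Complex.re_sum]
      refine Finset.sum_congr rfl fun μ _ => ?_
      rw [Complex.re_sum]
      refine Finset.sum_congr rfl fun ν _ => ?_
      rw [map_mul, Complex.conj_ofReal, mul_mul_mul_comm, ← Complex.ofReal_mul,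
        Complex.re_ofReal_mul]
    rw [this]
    exact Complex.normSq_nonneg _
  rw [hform]
  refine le_trans ?_ (Finset.single_le_sum (fun b _ => hnn b) (Finset.mem_univ a))
  refine le_trans (le_of_eq ?_) (hle a)
  simp_rw [hentry]
  refine Eq.trans (Finset.sum_congr rfl fun μ _ => ?_) (Finset.sum_subset hS fun μ _ hμ => ?_)
  · refine Finset.sum_subset hS fun ν _ hν => ?_
    simp [hS₀ ν hν]
  · refine Finset.sum_eq_zero fun ν _ => ?_
    simp [hS₀ μ hμ]

/-- If the closed form vanishes at `x`, then so do all matrix elements of all `δ_ν(x)`. -/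
theorem deltaEntry_eq_zero (hH : IsGibbsEigenbasis H g E)
    (hA : ∀ a, IsCoreJump (finiteSpan g) (A a) (B a) (B' a)) {β : ℝ} (hβ : 0 < β) {f : ℝ → ℂ}
    (hf : ∀ ν ∈ bohrFrequencies H, f ν ≠ 0) {x : X →L[ℂ] X}
    (hx : ClosedFormHasValue β f H A x 0) (a : α) (ν : ℝ) (j i : ι) :
    hH.deltaEntry (B a) (B' a) β ν j i x = 0 := by
  obtain ⟨-, z, hz, hzx, -, hz0⟩ := hx
  obtain ⟨S, hS, -, -⟩ := hH.finite_deltaEntry_ne_zero (B a) (B' a) β j i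
  let c : (X →L[ℂ] X) → ℝ → ℂ := fun x ν =>
    f ν * (Real.exp (β * ν / 4) : ℂ) * hH.deltaEntry (B a) (B' a) β ν j i x
  have hmat : ∀ u v : finiteSpan g,
      Tendsto (fun n => ⟪(u : X), z n v⟫_ℂ) atTop (𝓝 ⟪(u : X), x v⟫_ℂ) := by
    rintro ⟨u, hu⟩ ⟨v, hv⟩
    induction hu using Submodule.span_induction with
    | mem u hu =>
      obtain ⟨k, rfl⟩ := hu
      induction hv using Submodule.span_induction with
      | mem v hv =>
        obtain ⟨l, rfl⟩ := hv
        exact tendsto_inner_of_tendsto_hsNormSq g hzx k l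
      | zero => simp
      | add v w _ _ hv hw => simpa [inner_add_right] using hv.add hw
      | smul r v _ hv => simpa [inner_smul_right] using hv.const_mul r
    | zero => simp
    | add u w _ _ hu hw => simpa [inner_add_left] using hu.add hw
    | smul r u _ hu => simpa [inner_smul_left, mul_comm] using hu.const_mul ((starRingEnd ℂ) r)
  have hc : ∀ ν, Tendsto (fun n => c (z n) ν) atTop (𝓝 (c x ν)) := fun ν =>
    (((hmat _ (basisVec g i)).const_mul _).sub ((hmat (basisVec g j) _).const_mul _)).const_mul _
  have hlim : Tendsto (fun n => ∑ μ ∈ S, ∑ ν ∈ S, sechKernel β μ ν *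
      ((starRingEnd ℂ) (c (z n) μ) * c (z n) ν).re) atTop
      (𝓝 (∑ μ ∈ S, ∑ ν ∈ S, sechKernel β μ ν * ((starRingEnd ℂ) (c x μ) * c x ν).re)) := by
    refine tendsto_finsetSum _ fun μ _ => tendsto_finsetSum _ fun ν _ => Tendsto.const_mul _ ?_
    exact (Complex.continuous_re.tendsto _).comp
      (((Complex.continuous_conj.tendsto _).comp (hc μ)).mul (hc ν))
  have hle := le_of_tendsto_of_tendsto' hlim hz0 fun n =>
    hH.sum_deltaEntry_le_coreForm hA hβ f (hz n) a j i hS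
  have hzero := eq_zero_of_sum_sechKernel_re_nonpos hβ S (c x) hle
  by_cases hν : ν ∈ S
  · by_cases hB : ν ∈ bohrFrequencies H
    · have h := hzero ν hν
      refine (mul_eq_zero.mp h).resolve_left (mul_ne_zero (hf ν hB) ?_)
      exact_mod_cast (Real.exp_pos _).ne'
    · -- Off the Bohr frequencies, `E j - ν` and `E i + ν` are not energies.
      have h1 : E j - ν ∉ energies H := fun h =>
        hB ⟨E j, hH.energy_mem_energies j, E j - ν, h, by ring⟩
      have h2 : E i + ν ∉ energies H := fun h =>
        hB ⟨E i + ν, h, E i, hH.energy_mem_energies i, by ring⟩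
      simp only [deltaEntry, energyPart, hH.eigenProj_eq_zero_of_notMem h1,
        hH.eigenProj_eq_zero_of_notMem h2]
      simp
  · exact hS ν hν x

/-- The operator `e^{βH/4}` on the algebraic span of the eigenbasis. -/
def boltzmann (g : HilbertBasis ι ℂ X) (E : ι → ℝ) (β : ℝ) : finiteSpan g →ₗ[ℂ] X :=
  (coreBasis g).constr ℂ fun i => (Real.exp (β * E i / 4) : ℂ) • g i

omit [CompleteSpace X] in
theorem boltzmann_basisVec (g : HilbertBasis ι ℂ X) (E : ι → ℝ) (β : ℝ) (i : ι) :
    boltzmann g E β (basisVec g i) = (Real.exp (β * E i / 4) : ℂ) • g i := by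
  rw [← coreBasis_apply, boltzmann, Module.Basis.constr_basis]

omit [CompleteSpace X] in
theorem inner_boltzmann (g : HilbertBasis ι ℂ X) (E : ι → ℝ) (β : ℝ) (i : ι) (u : finiteSpan g) :
    ⟪g i, boltzmann g E β u⟫_ℂ = (Real.exp (β * E i / 4) : ℂ) * ⟪g i, (u : X)⟫_ℂ := by
  classical
  have : (innerSL ℂ (g i)).toLinearMap ∘ₗ boltzmann g E β =
      (Real.exp (β * E i / 4) : ℂ) • (innerSL ℂ (g i)).toLinearMap ∘ₗ (finiteSpan g).subtype := by
    refine (coreBasis g).ext fun k => ?_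
    rw [coreBasis_apply]
    change ⟪g i, boltzmann g E β (basisVec g k)⟫_ℂ = (Real.exp (β * E i / 4) : ℂ) * ⟪g i, g k⟫_ℂ
    rw [boltzmann_basisVec, inner_smul_right, inner_hilbertBasis]
    split_ifs with h
    · rw [h]
    · simp
  exact LinearMap.congr_fun this u

theorem boltzmann_energyPart (hH : IsGibbsEigenbasis H g E) (β t : ℝ) (v : X) :
    boltzmann g E β (hH.energyPart t v) = (Real.exp (β * t / 4) : ℂ) • eigenProj H t v := by
  refine ext_inner_hilbertBasis g fun i => ?_
  rw [inner_boltzmann, inner_smul_right, energyPart, hH.inner_eigenProj]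
  split_ifs with h
  · rw [h]
  · simp

/-- The sesquilinear form of `e^{βH/4} x e^{βH/4}`. -/
def gibbsForm (g : HilbertBasis ι ℂ X) (E : ι → ℝ) (β : ℝ) (x : X →L[ℂ] X) :
    finiteSpan g →ₗ⋆[ℂ] finiteSpan g →ₗ[ℂ] ℂ :=
  LinearMap.mk₂'ₛₗ (starRingEnd ℂ) (RingHom.id ℂ)
    (fun u v => ⟪boltzmann g E β u, x (boltzmann g E β v)⟫_ℂ)
    (fun u v w => by rw [map_add, inner_add_left])
    (fun c u w => by rw [map_smul, inner_smul_left, smul_eq_mul])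
    (fun u v w => by rw [map_add, map_add, inner_add_right])
    (fun c u w => by rw [map_smul, map_smul, inner_smul_right, RingHom.id_apply, smul_eq_mul])

omit [CompleteSpace X] in
theorem gibbsForm_apply (g : HilbertBasis ι ℂ X) (E : ι → ℝ) (β : ℝ) (x : X →L[ℂ] X)
    (u v : finiteSpan g) :
    gibbsForm g E β x u v = ⟪boltzmann g E β u, x (boltzmann g E β v)⟫_ℂ := rfl

/-- If all `δ_ν(x)` vanish, then `e^{βH/4} x e^{βH/4}` commutes with the jump: the twist by
`e^{±βν/4}` is undone by the Boltzmann factors, and summing over `ν` restores the whole jump. -/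
theorem gibbsForm_jump (hH : IsGibbsEigenbasis H g E) {B B' : finiteSpan g →ₗ[ℂ] finiteSpan g}
    {β : ℝ} {x : X →L[ℂ] X} (hx : ∀ ν j i, hH.deltaEntry B B' β ν j i x = 0)
    (u v : finiteSpan g) : gibbsForm g E β x (B' u) v = gibbsForm g E β x u (B v) := by
  have hbasis : ∀ j i, gibbsForm g E β x (B' (basisVec g j)) (basisVec g i) =
      gibbsForm g E β x (basisVec g j) (B (basisVec g i)) := by
    intro j i
    obtain ⟨S, -, hS1, hS2⟩ := hH.finite_deltaEntry_ne_zero B B' β j i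
    classical
    have e1 : B' (basisVec g j) = ∑ ν ∈ S, hH.energyPart (E j - ν) (B' (basisVec g j)) := by
      refine Subtype.ext ?_
      rw [Submodule.coe_sum]
      have h := hH.sum_eigenProj (v := B' (basisVec g j)) (S := S.image fun ν => E j - ν)
        fun t ht => by
          by_contra h
          refine ht ?_
          have := hS1 (E j - t) fun h' => h (Finset.mem_image.mpr ⟨_, h', by ring⟩)
          simpa using this
      rw [Finset.sum_image fun a _ b _ hab => by simpa using hab] at h
      exact h.symm
    have e2 : B (basisVec g i) = ∑ ν ∈ S, hH.energyPart (E i + ν) (B (basisVec g i)) := by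
      refine Subtype.ext ?_
      rw [Submodule.coe_sum]
      have h := hH.sum_eigenProj (v := B (basisVec g i)) (S := S.image fun ν => E i + ν)
        fun t ht => by
          by_contra h
          refine ht ?_
          have := hS2 (t - E i) fun h' => h (Finset.mem_image.mpr ⟨_, h', by ring⟩)
          simpa using this
      rw [Finset.sum_image fun a _ b _ hab => by simpa using hab] at h
      exact h.symm
    rw [e1, e2, map_sum, LinearMap.sum_apply, map_sum]
    refine Finset.sum_congr rfl fun ν _ => ?_
    rw [gibbsForm_apply, gibbsForm_apply, boltzmann_basisVec, boltzmann_basisVec,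
      hH.boltzmann_energyPart, hH.boltzmann_energyPart]
    have h := sub_eq_zero.mp (hx ν j i)
    simp only [energyPart] at h
    simp only [map_smul, inner_smul_left, inner_smul_right, Complex.conj_ofReal]
    have r1 : Real.exp (β * (E j - ν) / 4) * Real.exp (β * E i / 4) =
        Real.exp (β * (E j + E i) / 4) * Real.exp (-(β * ν / 4)) := by
      rw [← Real.exp_add, ← Real.exp_add]; ring_nf
    have r2 : Real.exp (β * E j / 4) * Real.exp (β * (E i + ν) / 4) =
        Real.exp (β * (E j + E i) / 4) * Real.exp (β * ν / 4) := by
      rw [← Real.exp_add, ← Real.exp_add]; ring_nf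
    rw [← Complex.ofReal_inj, Complex.ofReal_mul, Complex.ofReal_mul] at r1 r2
    linear_combination ⟪eigenProj H (E j - ν) (B' (basisVec g j) : X), x (g i)⟫_ℂ * r1 -
      ⟪g j, x (eigenProj H (E i + ν) (B (basisVec g i) : X))⟫_ℂ * r2 +
      (Real.exp (β * (E j + E i) / 4) : ℂ) * h
  have : (gibbsForm g E β x).comp B' = (gibbsForm g E β x).compl₂ B := by
    refine (coreBasis g).ext fun j => (coreBasis g).ext fun i => ?_
    rw [coreBasis_apply, coreBasis_apply]
    exact hbasis j i
  exact LinearMap.congr_fun (LinearMap.congr_fun this u) v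

/-- The kernel of the closed form is spanned by the square root of the Gibbs state as soon as the
jumps act irreducibly, in the sense that the only sesquilinear forms commuting with them are the
multiples of the inner product. -/
theorem closedForm_eq_zero_iff (hH : IsGibbsEigenbasis H g E)
    (hA : ∀ a, IsCoreJump (finiteSpan g) (A a) (B a) (B' a)) {β : ℝ} (hβ : 0 < β) {f : ℝ → ℂ}
    (hf : ∀ ν ∈ bohrFrequencies H, f ν ≠ 0)
    (hirr : ∀ Φ : finiteSpan g →ₗ⋆[ℂ] finiteSpan g →ₗ[ℂ] ℂ,
      (∀ a u v, Φ (B' a u) v = Φ u (B a v)) → ∃ c : ℂ, ∀ u v, Φ u v = c * ⟪(u : X), v⟫_ℂ)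
    (x : X →L[ℂ] X) :
    ClosedFormHasValue β f H A x 0 ↔ ∃ c : ℂ, x = c • expNeg H (β / 2) := by
  classical
  have hβ2 : 0 < β / 2 := by positivity
  constructor
  · intro hx
    obtain ⟨c, hc⟩ := hirr (gibbsForm g E β x) fun a =>
      hH.gibbsForm_jump (hH.deltaEntry_eq_zero hA hβ hf hx a)
    refine ⟨c, ?_⟩
    have hmat : ∀ j i, ⟪g j, x (g i)⟫_ℂ = ⟪g j, (c • expNeg H (β / 2)) (g i)⟫_ℂ := by
      intro j i
      have h := hc (basisVec g j) (basisVec g i)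
      rw [gibbsForm_apply, boltzmann_basisVec, boltzmann_basisVec] at h
      simp only [map_smul, inner_smul_left, inner_smul_right, Complex.conj_ofReal, basisVec] at h
      rw [smul_apply, inner_smul_right, hH.inner_expNeg hβ2]
      have e1 : (Real.exp (β * E i / 4) : ℂ) ≠ 0 := by exact_mod_cast (Real.exp_pos _).ne'
      have e2 : (Real.exp (β * E j / 4) : ℂ) ≠ 0 := by exact_mod_cast (Real.exp_pos _).ne'
      rw [inner_hilbertBasis] at h ⊢
      split_ifs at h ⊢ with hji
      · subst hji
        refine mul_left_cancel₀ e1 (mul_left_cancel₀ e2 (h.trans ?_))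
        have : (Real.exp (β * E j / 4) : ℂ) * ((Real.exp (β * E j / 4) : ℂ) *
            (Real.exp (-(β / 2 * E j)) : ℂ)) = 1 := by
          rw [← Complex.ofReal_mul, ← Complex.ofReal_mul, ← Real.exp_add, ← Real.exp_add]
          ring_nf
          simp
        linear_combination (-c) * this
      · simpa [e1, e2] using h
    have h1 : ∀ i, x (g i) = (c • expNeg H (β / 2)) (g i) := fun i =>
      ext_inner_hilbertBasis g fun j => hmat j i
    refine ContinuousLinearMap.ext_on (s := Set.range g) ?_ ?_
    · have := g.dense_span
      rw [dense_iff_closure_eq, ← Submodule.topologicalClosure_coe, this, Submodule.top_coe]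
    · rintro _ ⟨i, rfl⟩
      exact h1 i
  · rintro ⟨c, rfl⟩
    have hmem : c • expNeg H (β / 2) ∈ formCore β H :=
      Submodule.smul_mem _ _ (Submodule.mem_sup_right (Submodule.mem_span_singleton_self _))
    have hdelta : ∀ (d : ℂ) a ν, component β f H (A a) (d • expNeg H (β / 2)) ν = 0 := by
      intro d a ν
      have : delta β H (A a) ν (d • expNeg H (β / 2)) = 0 := by
        rw [delta_eq_tsum]
        simp [hH.deltaTerm_expNeg (hA a) hβ]
      rw [component, this, smul_zero]
    have hform : ∀ d : ℂ, coreForm β f H A (d • expNeg H (β / 2)) = 0 := by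
      intro d
      simp [coreForm, hdelta, hsInner]
    refine ⟨(hsClass X).smul_mem c (hH.isHilbertSchmidt_expNeg hβ2),
      fun _ => c • expNeg H (β / 2), fun _ => hmem, ?_, ?_, ?_⟩
    · simp [hsNormSq]
    · have h0 := hform 0
      rw [zero_smul] at h0
      simp [h0]
    · simp [hform]

end IsGibbsEigenbasis

end Kernel

/-! ### Operators closed from a core and their bounded perturbations -/

section CoreOperators

variable {V X : Type*} [AddCommGroup V] [Module ℂ V]
  [NormedAddCommGroup X] [InnerProductSpace ℂ X] {κ : Type*}

/-- The closed operator extends the operator on the core. (If that operator were not closable,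
`closedOp` would be the operator itself, and the claim still holds.) -/
theorem closedOp_core {J : V →ₗ[ℂ] X} (hJ : Function.Injective J) (T : V →ₗ[ℂ] V) (v : V) :
    ∃ h : J v ∈ (closedOp J hJ T).domain, closedOp J hJ T ⟨J v, h⟩ = J (T v) := by
  have hle : onCore J hJ T ≤ closedOp J hJ T := (onCore J hJ T).le_closure
  have hv : J v ∈ (onCore J hJ T).domain := ⟨v, rfl⟩
  refine ⟨hle.1 hv, ?_⟩
  rw [← hle.2 (x := ⟨J v, hv⟩) rfl]
  change J (T ((LinearEquiv.ofInjective J hJ).symm ⟨J v, hv⟩)) = J (T v)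
  congr 2
  exact (LinearEquiv.ofInjective J hJ).symm_apply_apply v

/-- A relation `⟪w, T v⟫ = μ ⟪w, v⟫` on the core passes to the closed operator, because it is a
closed condition on the graph. -/
theorem inner_closedOp {J : V →ₗ[ℂ] X} (hJ : Function.Injective J) {T : V →ₗ[ℂ] V} {w : X} {μ : ℂ}
    (h : ∀ v, ⟪w, J (T v)⟫_ℂ = μ * ⟪w, J v⟫_ℂ) (v : (closedOp J hJ T).domain) :
    ⟪w, closedOp J hJ T v⟫_ℂ = μ * ⟪w, (v : X)⟫_ℂ := by
  have hcore : ∀ u : (onCore J hJ T).domain, ⟪w, onCore J hJ T u⟫_ℂ = μ * ⟪w, (u : X)⟫_ℂ := by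
    rintro ⟨_, u, rfl⟩
    rw [← h u]
    congr 1
    change J (T ((LinearEquiv.ofInjective J hJ).symm _)) = J (T u)
    congr 2
    exact (LinearEquiv.ofInjective J hJ).symm_apply_apply u
  by_cases hc : (onCore J hJ T).IsClosable
  · have hg := hc.graph_closure_eq_closure_graph
    have hmem : ((v : X), closedOp J hJ T v) ∈ (onCore J hJ T).graph.topologicalClosure :=
      hg ▸ (closedOp J hJ T).mem_graph v
    have hcl : IsClosed {p : X × X | ⟪w, p.2⟫_ℂ = μ * ⟪w, p.1⟫_ℂ} :=
      isClosed_eq (continuous_const.inner continuous_snd)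
        (continuous_const.mul (continuous_const.inner continuous_fst))
    refine closure_minimal ?_ hcl hmem
    intro p hp
    obtain ⟨u, hu1, hu2⟩ := (onCore J hJ T).mem_graph_iff.mp hp
    change ⟪w, p.2⟫_ℂ = μ * ⟪w, p.1⟫_ℂ
    rw [← hu1, ← hu2]
    exact hcore u
  · have : closedOp J hJ T = onCore J hJ T := LinearPMap.closure_def' hc
    revert v
    rw [this]
    exact hcore

section CoreMap

theorem span_le_comap {ψ : κ → V} {T : V →ₗ[ℂ] V}
    (hT : ∀ k, T (ψ k) ∈ Submodule.span ℂ (Set.range ψ)) :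
    Submodule.span ℂ (Set.range ψ) ≤ (Submodule.span ℂ (Set.range ψ)).comap T :=
  Submodule.span_le.mpr (by rintro _ ⟨k, rfl⟩; exact hT k)

theorem map_span_core {J : V →ₗ[ℂ] X} {ψ : κ → V} {e : HilbertBasis κ ℂ X}
    (hψ : ∀ k, J (ψ k) = e k) : (Submodule.span ℂ (Set.range ψ)).map J = finiteSpan e := by
  rw [Submodule.map_span, ← Set.range_comp, finiteSpan]
  congr 2
  exact funext hψ

variable {J : V →ₗ[ℂ] X} (hJ : Function.Injective J) {ψ : κ → V} {e : HilbertBasis κ ℂ X}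
  (hψ : ∀ k, J (ψ k) = e k)

/-- The action on the algebraic span of the basis `J (ψ k)` of an operator `T` on the core that
preserves the span of the `ψ k`. -/
def coreMap (T : V →ₗ[ℂ] V) (hT : ∀ k, T (ψ k) ∈ Submodule.span ℂ (Set.range ψ)) :
    finiteSpan e →ₗ[ℂ] finiteSpan e :=
  let φ := (Submodule.equivMapOfInjective J hJ (Submodule.span ℂ (Set.range ψ))).trans
    (LinearEquiv.ofEq _ _ (map_span_core hψ))
  φ.toLinearMap ∘ₗ (T.restrict (span_le_comap hT)) ∘ₗ φ.symm.toLinearMap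

theorem coreMap_apply (T : V →ₗ[ℂ] V) (hT : ∀ k, T (ψ k) ∈ Submodule.span ℂ (Set.range ψ))
    (v : V) (u : finiteSpan e) (h : J v = u) : (coreMap hJ hψ T hT u : X) = J (T v) := by
  let φ := (Submodule.equivMapOfInjective J hJ (Submodule.span ℂ (Set.range ψ))).trans
    (LinearEquiv.ofEq _ _ (map_span_core hψ))
  obtain ⟨w, rfl⟩ := φ.surjective u
  have hw : (φ w : X) = J w := rfl
  have hvw : v = w := hJ (h.trans hw)
  subst hvw
  change (φ (T.restrict (span_le_comap hT) (φ.symm (φ w))) : X) = _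
  rw [φ.symm_apply_apply]
  rfl

/-- A core operator and its formal adjoint that preserve the span of the `ψ k` give a jump on the
algebraic span of the basis `J (ψ k)`. -/
theorem isCoreJump_closedOp {T T' : V →ₗ[ℂ] V}
    (hT : ∀ k, T (ψ k) ∈ Submodule.span ℂ (Set.range ψ))
    (hT' : ∀ k, T' (ψ k) ∈ Submodule.span ℂ (Set.range ψ))
    (hadj : ∀ u v, ⟪J (T' u), J v⟫_ℂ = ⟪J u, J (T v)⟫_ℂ) :
    IsCoreJump (finiteSpan e) (closedOp J hJ T) (coreMap hJ hψ T hT) (coreMap hJ hψ T' hT') := by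
  have hpre : ∀ u : finiteSpan e, ∃ v, J v = u := by
    rintro ⟨u, hu⟩
    rw [← map_span_core hψ] at hu
    obtain ⟨v, -, rfl⟩ := hu
    exact ⟨v, rfl⟩
  constructor
  · intro u
    obtain ⟨v, hv⟩ := hpre u
    rw [coreMap_apply hJ hψ T hT v u hv, ← hv]
    exact closedOp_core hJ T v
  · intro u v
    obtain ⟨u', hu⟩ := hpre u
    obtain ⟨v', hv⟩ := hpre v
    rw [coreMap_apply hJ hψ T hT v' v hv, coreMap_apply hJ hψ T' hT' u' u hu, ← hu, ← hv, hadj]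

end CoreMap

end CoreOperators

/-! ### Low-energy perturbations of a diagonal operator -/

section Perturbation

variable {V X : Type*} [AddCommGroup V] [Module ℂ V]
  [NormedAddCommGroup X] [InnerProductSpace ℂ X] {κ : Type*}

/-- `e` is a Hilbert basis of vectors `J (ψ k)` of the core that diagonalizes the symmetric core
operator `N` with eigenvalues `ℓ k`. -/
structure IsDiagonalCore (J : V →ₗ[ℂ] X) (N : V →ₗ[ℂ] V) (ψ : κ → V) (e : HilbertBasis κ ℂ X)
    (ℓ : κ → ℕ) : Prop where
  basis : ∀ k, J (ψ k) = e k
  diag : ∀ k, N (ψ k) = (ℓ k : ℂ) • ψ k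
  symm : ∀ u v, ⟪J (N u), J v⟫_ℂ = ⟪J u, J (N v)⟫_ℂ

namespace IsDiagonalCore

variable {J : V →ₗ[ℂ] X} {N : V →ₗ[ℂ] V} {ψ : κ → V} {e : HilbertBasis κ ℂ X} {ℓ : κ → ℕ}

theorem pow_apply (h : IsDiagonalCore J N ψ e ℓ) (m : ℕ) (k : κ) :
    (N ^ m) (ψ k) = ((ℓ k : ℂ) ^ m) • ψ k := by
  induction m with
  | zero => simp
  | succ m ih => rw [pow_succ', Module.End.mul_apply, ih, map_smul, h.diag, smul_smul, pow_succ]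

theorem pow_symm (h : IsDiagonalCore J N ψ e ℓ) (m : ℕ) (u v : V) :
    ⟪J ((N ^ m) u), J v⟫_ℂ = ⟪J u, J ((N ^ m) v)⟫_ℂ := by
  induction m generalizing u v with
  | zero => simp
  | succ m ih =>
    rw [pow_succ', Module.End.mul_apply, h.symm, ih, ← Module.End.mul_apply, ← pow_succ,
      ← pow_succ']

theorem inner_pow (h : IsDiagonalCore J N ψ e ℓ) (m : ℕ) (k : κ) (v : V) :
    ⟪e k, J ((N ^ m) v)⟫_ℂ = (ℓ k : ℂ) ^ m * ⟪e k, J v⟫_ℂ := by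
  rw [← h.basis, ← h.pow_symm, h.pow_apply, map_smul, inner_smul_left, map_pow,
    Complex.conj_natCast]

variable (hJ : Function.Injective J)

theorem closedOp_basis (h : IsDiagonalCore J N ψ e ℓ) (m : ℕ) (k : κ) :
    ∃ hk : e k ∈ (closedOp J hJ (N ^ m)).domain,
      closedOp J hJ (N ^ m) ⟨e k, hk⟩ = ((ℓ k : ℂ) ^ m) • e k := by
  have := closedOp_core hJ (N ^ m) (ψ k)
  rwa [h.pow_apply, map_smul, h.basis] at this

theorem inner_closedOp_pow (h : IsDiagonalCore J N ψ e ℓ) (m : ℕ) (k : κ)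
    (v : (closedOp J hJ (N ^ m)).domain) :
    ⟪e k, closedOp J hJ (N ^ m) v⟫_ℂ = (ℓ k : ℂ) ^ m * ⟪e k, (v : X)⟫_ℂ :=
  inner_closedOp hJ (h.inner_pow m k) v

variable [CompleteSpace X]

/-- A low-energy perturbation vanishes on the basis vectors of high energy. -/
theorem perturbation_apply_eq_zero (h : IsDiagonalCore J N ψ e ℓ) {n : ℕ} {K : X →L[ℂ] X}
    (hK : IsLowEnergyPerturbation (closedOp J hJ (N ^ 1)) n K) {k : κ} (hk : n < ℓ k) :
    K (e k) = 0 := by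
  have hP : spectralProj (closedOp J hJ (N ^ 1)) (Set.Icc 0 (n : ℝ)) (e k) = 0 := by
    rw [spectralProj, Submodule.starProjection_apply_eq_zero_iff, Submodule.orthogonal_closure]
    have hle : (⨆ t ∈ Set.Icc 0 (n : ℝ), eigenspace (closedOp J hJ (N ^ 1)) t) ≤
        (Submodule.span ℂ {e k})ᗮ := by
      refine iSup₂_le fun t ht v hv => ?_
      rw [Submodule.mem_orthogonal_singleton_iff_inner_right]
      obtain ⟨hv, hv'⟩ := hv
      have h1 := h.inner_closedOp_pow hJ 1 k ⟨v, hv⟩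
      rw [hv', inner_smul_right, pow_one] at h1
      have h2 : ((t : ℂ) - ℓ k) * ⟪e k, v⟫_ℂ = 0 := by rw [sub_mul, h1, sub_self]
      refine (mul_eq_zero.mp h2).resolve_left fun h3 => ?_
      have h4 : t = ℓ k := by exact_mod_cast sub_eq_zero.mp h3
      have h5 : (n : ℝ) < ℓ k := by exact_mod_cast hk
      linarith [ht.2]
    exact Submodule.orthogonal_le hle
      (Submodule.le_orthogonal_orthogonal _ (Submodule.mem_span_singleton_self _))
  rw [hK.lowEnergy, ContinuousLinearMap.comp_apply, ContinuousLinearMap.comp_apply, hP, map_zero,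
    map_zero]

end IsDiagonalCore

end Perturbation

section PerturbedBasis

variable {V X : Type*} [AddCommGroup V] [Module ℂ V]
  [NormedAddCommGroup X] [InnerProductSpace ℂ X] [CompleteSpace X] {κ : Type}

namespace IsDiagonalCore

variable {J : V →ₗ[ℂ] X} {N : V →ₗ[ℂ] V} {ψ : κ → V} {e : HilbertBasis κ ℂ X} {ℓ : κ → ℕ}

/-- A diagonal operator perturbed at low energies again has an eigenbasis with the same algebraic
span: the low-energy block is diagonalized by the finite-dimensional spectral theorem, and the basis
vectors of high energy are kept. -/
theorem exists_isGibbsEigenbasis (h : IsDiagonalCore J N ψ e ℓ) (hJ : Function.Injective J)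
    (hfin : ∀ n, {k | ℓ k ≤ n}.Finite) {m : ℕ}
    (hsum : ∀ s : ℝ, 0 < s → Summable fun k => Real.exp (-(s * (ℓ k : ℝ) ^ m)))
    {n : ℕ} {K : X →L[ℂ] X} (hK : IsLowEnergyPerturbation (closedOp J hJ (N ^ 1)) n K) :
    ∃ (ι : Type) (g : HilbertBasis ι ℂ X) (E : ι → ℝ),
      IsGibbsEigenbasis (addBounded (closedOp J hJ (N ^ m)) K) g E ∧
        finiteSpan g = finiteSpan e := by
  classical
  set H := addBounded (closedOp J hJ (N ^ m)) K with hH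
  let low : Finset κ := (hfin n).toFinset
  have hlow : ∀ k, k ∈ low ↔ ℓ k ≤ n := fun k => by simp [low]
  have hKhigh : ∀ k ∉ low, K (e k) = 0 := fun k hk =>
    h.perturbation_apply_eq_zero hJ hK (by rw [hlow] at hk; omega)
  have hKhigh' : ∀ k ∉ low, ∀ v, ⟪e k, K v⟫_ℂ = 0 := by
    intro k hk v
    rw [← ContinuousLinearMap.adjoint_inner_left, hK.selfAdjoint.adjoint_eq, hKhigh k hk,
      inner_zero_left]
  -- The low-energy block `D` of the perturbed operator, acting on the span `L`.
  let L : Submodule ℂ X := Submodule.span ℂ (e '' low)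
  have : FiniteDimensional ℂ L := FiniteDimensional.span_of_finite ℂ (low.finite_toSet.image e)
  have mem_L : ∀ v, (∀ k ∉ low, ⟪e k, v⟫_ℂ = 0) → v ∈ L := by
    intro v hv
    rw [eq_sum_inner_smul e hv]
    exact Submodule.sum_mem _ fun k hk =>
      Submodule.smul_mem _ _ (Submodule.subset_span ⟨k, hk, rfl⟩)
  have hL : ∀ v ∈ L, ∀ k ∉ low, ⟪e k, v⟫_ℂ = 0 := by
    intro v hv k hk
    induction hv using Submodule.span_induction with
    | mem v hv =>
      obtain ⟨l, hl, rfl⟩ := hv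
      rw [inner_hilbertBasis, if_neg]
      rintro rfl
      exact hk hl
    | zero => simp
    | add u v _ _ hu hv => rw [inner_add_right, hu, hv, add_zero]
    | smul c v _ hv => rw [inner_smul_right, hv, mul_zero]
  let D : X →L[ℂ] X :=
    ∑ k ∈ low, ((ℓ k : ℂ) ^ m) • InnerProductSpace.rankOne ℂ (e k) (e k) + K
  have hD : ∀ k ∈ low, D (e k) = ((ℓ k : ℂ) ^ m) • e k + K (e k) := by
    intro k hk
    simp only [D, add_apply, sum_apply,
      smul_apply, InnerProductSpace.rankOne_apply]
    rw [Finset.sum_eq_single k]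
    · rw [inner_hilbertBasis, if_pos rfl, one_smul]
    · intro l _ hl
      rw [inner_hilbertBasis, if_neg hl, zero_smul, smul_zero]
    · exact fun h => absurd hk h
  have hDL : ∀ v ∈ L, D v ∈ L := by
    intro v _
    refine mem_L _ fun k hk => ?_
    simp only [D, add_apply, sum_apply,
      smul_apply, InnerProductSpace.rankOne_apply, inner_add_right, inner_sum,
      inner_smul_right, hKhigh' k hk, add_zero]
    refine Finset.sum_eq_zero fun l hl => ?_
    rw [inner_hilbertBasis, if_neg (by rintro rfl; exact hk hl)]
    simp
  have hDsymm : D.toLinearMap.IsSymmetric := by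
    intro u v
    change ⟪D u, v⟫_ℂ = ⟪u, D v⟫_ℂ
    have hKs : ⟪K u, v⟫_ℂ = ⟪u, K v⟫_ℂ := by
      rw [← ContinuousLinearMap.adjoint_inner_left, hK.selfAdjoint.adjoint_eq]
    simp only [D, add_apply, sum_apply,
      smul_apply, InnerProductSpace.rankOne_apply, inner_add_right, inner_sum,
      inner_smul_right, inner_add_left, sum_inner, inner_smul_left, map_pow, Complex.conj_natCast,
      inner_conj_symm, hKs]
    congr 1
    exact Finset.sum_congr rfl fun k _ => by ring
  -- `H` acts as `D` on `L`, and `D` is its adjoint there.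
  have hHL : ∀ v ∈ L, ∃ hv : v ∈ H.domain, H ⟨v, hv⟩ = D v := by
    intro v hv
    induction hv using Submodule.span_induction with
    | mem v hv =>
      obtain ⟨k, hk, rfl⟩ := hv
      obtain ⟨h1, h2⟩ := h.closedOp_basis hJ m k
      refine ⟨h1, ?_⟩
      rw [hD k hk, ← h2]
      rfl
    | zero => exact ⟨H.domain.zero_mem, (H.map_zero).trans (map_zero D).symm⟩
    | add u v _ _ hu hv =>
      obtain ⟨hu, hu'⟩ := hu
      obtain ⟨hv, hv'⟩ := hv
      exact ⟨H.domain.add_mem hu hv, by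
        rw [map_add, ← hu', ← hv']; exact H.map_add ⟨u, hu⟩ ⟨v, hv⟩⟩
    | smul c v _ hv =>
      obtain ⟨hv, hv'⟩ := hv
      exact ⟨H.domain.smul_mem c hv, by
        rw [map_smul, ← hv']; exact H.map_smul c ⟨v, hv⟩⟩
  have hHe : ∀ k (v : H.domain),
      ⟪e k, H v⟫_ℂ = (ℓ k : ℂ) ^ m * ⟪e k, (v : X)⟫_ℂ + ⟪e k, K v⟫_ℂ := by
    intro k v
    rw [← h.inner_closedOp_pow hJ m k v, ← inner_add_right]
    rfl
  have hHD : ∀ w ∈ L, ∀ v : H.domain, ⟪w, H v⟫_ℂ = ⟪D w, (v : X)⟫_ℂ := by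
    intro w hw v
    induction hw using Submodule.span_induction with
    | mem w hw =>
      obtain ⟨k, hk, rfl⟩ := hw
      rw [hHe, hD k hk, inner_add_left, inner_smul_left, map_pow, Complex.conj_natCast,
        ← ContinuousLinearMap.adjoint_inner_left, hK.selfAdjoint.adjoint_eq]
    | zero => simp
    | add u w _ _ hu hw => rw [inner_add_left, hu, hw, map_add, inner_add_left]
    | smul c w _ hw => rw [inner_smul_left, hw, map_smul, inner_smul_left]
  have hT := hDsymm.restrict_invariant hDL
  let b := hT.eigenvectorBasis (n := Module.finrank ℂ L) rfl
  let ev := hT.eigenvalues (n := Module.finrank ℂ L) rfl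
  have hb : ∀ i, D (b i) = (ev i : ℂ) • (b i : X) := fun i =>
    congrArg Subtype.val (hT.apply_eigenvectorBasis rfl i)
  let G : Fin (Module.finrank ℂ L) ⊕ {k // k ∉ low} → X :=
    Sum.elim (fun i => (b i : X)) fun k => e k
  have hG : Orthonormal ℂ G := by
    rw [orthonormal_iff_ite]
    rintro (i | k) (j | l)
    · have := orthonormal_iff_ite.mp b.orthonormal i j
      simp only [Sum.inl.injEq]
      exact this
    · rw [if_neg (by simp), ← inner_conj_symm]
      change (starRingEnd ℂ) ⟪e l, (b i : X)⟫_ℂ = 0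
      rw [hL _ (b i).2 l l.2, map_zero]
    · rw [if_neg (by simp)]
      exact hL _ (b j).2 k k.2
    · have := inner_hilbertBasis e k l
      simp only [Sum.inr.injEq, Subtype.ext_iff]
      exact this
  have hLspan : L ≤ Submodule.span ℂ (Set.range G) := by
    intro v hv
    have h1 : ((⟨v, hv⟩ : L) : X) = ∑ i, (b.repr ⟨v, hv⟩ i) • (b i : X) := by
      conv_lhs => rw [← b.sum_repr ⟨v, hv⟩]
      simp
    change ((⟨v, hv⟩ : L) : X) ∈ _
    rw [h1]
    exact Submodule.sum_mem _ fun i _ =>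
      Submodule.smul_mem _ _ (Submodule.subset_span ⟨Sum.inl i, rfl⟩)
  have hspan : Submodule.span ℂ (Set.range G) = finiteSpan e := by
    refine le_antisymm (Submodule.span_le.mpr ?_) (Submodule.span_le.mpr ?_)
    · rintro _ ⟨i | k, rfl⟩
      · refine Submodule.span_mono ?_ (b i).2
        rintro _ ⟨k, -, rfl⟩
        exact ⟨k, rfl⟩
      · exact basis_mem_finiteSpan e k
    · rintro _ ⟨k, rfl⟩
      by_cases hk : k ∈ low
      · exact hLspan (Submodule.subset_span ⟨k, hk, rfl⟩)
      · exact Submodule.subset_span ⟨Sum.inr ⟨k, hk⟩, rfl⟩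
  have hdense : ⊤ ≤ (Submodule.span ℂ (Set.range G)).topologicalClosure := by
    rw [hspan]
    exact e.dense_span.ge
  have hcoe : ⇑(HilbertBasis.mk hG hdense) = G := HilbertBasis.coe_mk hG hdense
  refine ⟨_, HilbertBasis.mk hG hdense,
    Sum.elim ev fun k => (ℓ k : ℝ) ^ m, ⟨?_, ?_, ?_⟩, by rw [finiteSpan, hcoe, hspan]⟩
  · rw [hcoe]
    rintro (i | k)
    · obtain ⟨h1, h2⟩ := hHL _ (b i).2
      exact ⟨h1, h2.trans (hb i)⟩
    · obtain ⟨h1, h2⟩ := h.closedOp_basis hJ m k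
      refine ⟨h1, ?_⟩
      have h3 : H ⟨e k, h1⟩ = closedOp J hJ (N ^ m) ⟨e k, h1⟩ + K (e k) := rfl
      refine h3.trans ?_
      rw [h2, hKhigh k k.2, add_zero]
      simp [G]
  · rw [hcoe]
    rintro (i | k) v
    · change ⟪(b i : X), H v⟫_ℂ = (ev i : ℂ) * ⟪(b i : X), (v : X)⟫_ℂ
      rw [hHD _ (b i).2, hb, inner_smul_left, Complex.conj_ofReal]
    · change ⟪e k, H v⟫_ℂ = (((ℓ k : ℝ) ^ m : ℝ) : ℂ) * ⟪e k, (v : X)⟫_ℂ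
      rw [hHe, hKhigh' k k.2, add_zero]
      push_cast
      rfl
  · intro s hs
    exact Summable.sum _ (summable_of_hasFiniteSupport (Set.toFinite _))
      ((hsum s hs).comp_injective (Subtype.val_injective (p := fun k => k ∉ low)))

/-- The kernel theorem for low-energy perturbations of a diagonal core operator. -/
theorem closedForm_eq_zero_iff {α : Type*} [Fintype α] (h : IsDiagonalCore J N ψ e ℓ)
    (hJ : Function.Injective J) (hfin : ∀ n, {k | ℓ k ≤ n}.Finite) {m : ℕ}
    (hsum : ∀ s : ℝ, 0 < s → Summable fun k => Real.exp (-(s * (ℓ k : ℝ) ^ m)))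
    {n : ℕ} {K : X →L[ℂ] X} (hK : IsLowEnergyPerturbation (closedOp J hJ (N ^ 1)) n K)
    {A : α → X →ₗ.[ℂ] X} {B B' : α → finiteSpan e →ₗ[ℂ] finiteSpan e}
    (hA : ∀ a, IsCoreJump (finiteSpan e) (A a) (B a) (B' a))
    (hirr : ∀ Φ : finiteSpan e →ₗ⋆[ℂ] finiteSpan e →ₗ[ℂ] ℂ,
      (∀ a u v, Φ (B' a u) v = Φ u (B a v)) → ∃ c : ℂ, ∀ k l,
        Φ (basisVec e k) (basisVec e l) = c * ⟪e k, e l⟫_ℂ)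
    {β : ℝ} (hβ : 0 < β) {f : ℝ → ℂ}
    (hf : ∀ ν ∈ bohrFrequencies (addBounded (closedOp J hJ (N ^ m)) K), f ν ≠ 0)
    (x : X →L[ℂ] X) :
    ClosedFormHasValue β f (addBounded (closedOp J hJ (N ^ m)) K) A x 0 ↔
      ∃ c : ℂ, x = c • expNeg (addBounded (closedOp J hJ (N ^ m)) K) (β / 2) := by
  have hirr' : ∀ Φ : finiteSpan e →ₗ⋆[ℂ] finiteSpan e →ₗ[ℂ] ℂ,
      (∀ a u v, Φ (B' a u) v = Φ u (B a v)) → ∃ c : ℂ, ∀ u v, Φ u v = c * ⟪(u : X), v⟫_ℂ := by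
    intro Φ hΦ
    obtain ⟨c, hc⟩ := hirr Φ hΦ
    refine ⟨c, fun u v => ?_⟩
    have key : Φ = c • ((innerₛₗ ℂ).comp (finiteSpan e).subtype).compl₂ (finiteSpan e).subtype := by
      refine (coreBasis e).ext fun k => (coreBasis e).ext fun l => ?_
      rw [coreBasis_apply, coreBasis_apply]
      exact hc k l
    exact LinearMap.congr_fun (LinearMap.congr_fun key u) v
  obtain ⟨ι, g, E, hg, hspan⟩ := h.exists_isGibbsEigenbasis hJ hfin hsum hK
  clear hirr
  revert B B'
  rw [← hspan]
  intro B B' hA hirr'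
  exact hg.closedForm_eq_zero_iff hA hβ hf hirr' x

end IsDiagonalCore

end PerturbedBasis

/-! ### The circle -/

section Circle

theorem inner_periodicToL2 (u v : smoothPeriodic) :
    ⟪periodicToL2 u, periodicToL2 v⟫_ℂ = (2 * Real.pi : ℝ)⁻¹ •
      ∫ x in (0 : ℝ)..(2 * Real.pi), (v : ℝ → ℂ) x * (starRingEnd ℂ) ((u : ℝ → ℂ) x) := by
  have h1 : ⟪periodicToL2 u, periodicToL2 v⟫_ℂ = ∫ x : AddCircle (2 * Real.pi),
      periodicToCircle v x * (starRingEnd ℂ) (periodicToCircle u x)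
        ∂(AddCircle.haarAddCircle (T := 2 * Real.pi)) :=
    ContinuousMap.inner_toLp _ _ _
  rw [h1, AddCircle.integral_haarAddCircle, ← AddCircle.intervalIntegral_preimage _ 0, zero_add]
  rfl

/-- Integration by parts; the boundary terms cancel by periodicity. -/
theorem momentumS_symm (u v : smoothPeriodic) :
    ⟪periodicToL2 (momentumS u), periodicToL2 v⟫_ℂ =
      ⟪periodicToL2 u, periodicToL2 (momentumS v)⟫_ℂ := by
  rw [inner_periodicToL2, inner_periodicToL2, ← sub_eq_zero, ← smul_sub]
  have hu := contDiff_infty_iff_deriv.mp u.2.1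
  have hv := contDiff_infty_iff_deriv.mp v.2.1
  have hd : ∀ x, HasDerivAt (fun x => Complex.I * ((v : ℝ → ℂ) x *
      (starRingEnd ℂ) ((u : ℝ → ℂ) x)))
      (Complex.I * (deriv (v : ℝ → ℂ) x * (starRingEnd ℂ) ((u : ℝ → ℂ) x) +
        (v : ℝ → ℂ) x * (starRingEnd ℂ) (deriv (u : ℝ → ℂ) x))) x := fun x =>
    ((hv.1 x).hasDerivAt.mul (hu.1 x).hasDerivAt.star).const_mul _
  have hcu := hu.2.continuous
  have hcv := hv.2.continuous
  have hcu' := u.2.1.continuous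
  have hcv' := v.2.1.continuous
  have hint : Continuous fun x => (Complex.I * (deriv (v : ℝ → ℂ) x *
      (starRingEnd ℂ) ((u : ℝ → ℂ) x) +
        (v : ℝ → ℂ) x * (starRingEnd ℂ) (deriv (u : ℝ → ℂ) x))) :=
    continuous_const.mul ((hcv.mul (Complex.continuous_conj.comp hcu')).add
      (hcv'.mul (Complex.continuous_conj.comp hcu)))
  have key := intervalIntegral.integral_eq_sub_of_hasDerivAt (a := 0) (b := 2 * Real.pi)
    (fun x _ => hd x) (hint.intervalIntegrable _ _)
  have e1 := u.2.2 0
  have e2 := v.2.2 0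
  rw [zero_add] at e1 e2
  rw [e1, e2, sub_self] at key
  rw [← intervalIntegral.integral_sub]
  · refine (congrArg _ (Eq.trans ?_ key)).trans (smul_zero _)
    refine intervalIntegral.integral_congr fun x _ => ?_
    change (v : ℝ → ℂ) x * (starRingEnd ℂ) (-Complex.I * deriv (u : ℝ → ℂ) x) -
      (-Complex.I * deriv (v : ℝ → ℂ) x) * (starRingEnd ℂ) ((u : ℝ → ℂ) x) = _
    simp only [map_mul, map_neg, Complex.conj_I]
    ring
  · exact (hcv'.mul (Complex.continuous_conj.comp
      (continuous_const.mul hcu))).intervalIntegrable _ _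
  · exact ((continuous_const.mul hcv).mul
      (Complex.continuous_conj.comp hcu')).intervalIntegrable _ _

theorem phaseS_adjoint (k : ℤ) (u v : smoothPeriodic) :
    ⟪periodicToL2 (phaseS (-k) u), periodicToL2 v⟫_ℂ =
      ⟪periodicToL2 u, periodicToL2 (phaseS k v)⟫_ℂ := by
  rw [inner_periodicToL2, inner_periodicToL2]
  congr 1
  refine intervalIntegral.integral_congr fun x _ => ?_
  change (v : ℝ → ℂ) x * (starRingEnd ℂ) (Complex.exp (Complex.I * ((-k : ℤ) : ℂ) * x) *
      (u : ℝ → ℂ) x) =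
    (Complex.exp (Complex.I * k * x) * (v : ℝ → ℂ) x) * (starRingEnd ℂ) ((u : ℝ → ℂ) x)
  rw [map_mul, ← Complex.exp_conj]
  simp only [map_mul, Complex.conj_I, Complex.conj_ofReal, map_intCast]
  push_cast
  ring_nf

/-- The plane wave `e^{ikx}`. -/
def planeWave (k : ℤ) : smoothPeriodic :=
  phaseS k ⟨fun _ => 1, contDiff_const, fun _ => rfl⟩

theorem planeWave_apply (k : ℤ) (x : ℝ) :
    (planeWave k : ℝ → ℂ) x = Complex.exp (Complex.I * k * x) := mul_one _

theorem phaseS_planeWave (j k : ℤ) : phaseS j (planeWave k) = planeWave (j + k) := by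
  refine Subtype.ext (funext fun x => ?_)
  rw [planeWave_apply]
  change Complex.exp (Complex.I * j * x) * (planeWave k : ℝ → ℂ) x = _
  rw [planeWave_apply, ← Complex.exp_add]
  push_cast
  ring_nf

theorem momentumS_planeWave (k : ℤ) : momentumS (planeWave k) = (k : ℂ) • planeWave k := by
  refine Subtype.ext (funext fun x => ?_)
  have hfun : (planeWave k : ℝ → ℂ) = fun x : ℝ => Complex.exp (Complex.I * k * x) :=
    funext (planeWave_apply k)
  change -Complex.I * deriv (planeWave k : ℝ → ℂ) x = (k : ℂ) * (planeWave k : ℝ → ℂ) x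
  have hd : HasDerivAt (fun x : ℝ => Complex.exp (Complex.I * k * x))
      (Complex.exp (Complex.I * k * x) * (Complex.I * k * 1)) x :=
    ((Complex.ofRealCLM.hasDerivAt.const_mul (Complex.I * k))).cexp
  rw [hfun, hd.deriv]
  linear_combination (-(k : ℂ) * Complex.exp (Complex.I * k * x)) * Complex.I_sq

theorem periodicToL2_planeWave (k : ℤ) :
    periodicToL2 (planeWave k) = fourierBasis (T := 2 * Real.pi) k := by
  rw [coe_fourierBasis, fourierLp]
  change ContinuousMap.toLp 2 _ ℂ (periodicToCircle (planeWave k)) = _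
  congr 1
  ext x
  induction x using QuotientAddGroup.induction_on with
  | H x =>
    change (planeWave k : ℝ → ℂ) x = fourier k (x : AddCircle (2 * Real.pi))
    rw [planeWave_apply, fourier_coe_apply]
    congr 1
    have : (Real.pi : ℂ) ≠ 0 := by exact_mod_cast Real.pi_ne_zero
    push_cast
    field_simp

/-- The plane waves diagonalize `D_x²`, with eigenvalues `k²`. -/
theorem isDiagonalCore_circle : IsDiagonalCore periodicToL2 (momentumS * momentumS) planeWave
    (fourierBasis (T := 2 * Real.pi)) fun k => k.natAbs ^ 2 where
  basis := periodicToL2_planeWave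
  diag k := by
    rw [Module.End.mul_apply, momentumS_planeWave, map_smul, momentumS_planeWave, smul_smul]
    congr 1
    rw [← sq]
    rw [← Int.cast_pow, ← Int.natAbs_sq k, Int.cast_pow, Int.cast_natCast,
      Nat.cast_pow]
  symm u v := by
    rw [Module.End.mul_apply, Module.End.mul_apply, momentumS_symm, momentumS_symm]

theorem summable_exp_neg_natCast {s : ℝ} (hs : 0 < s) :
    Summable fun n : ℕ => Real.exp (-(s * n)) := by
  have := Real.summable_exp_nat_mul_iff.mpr (neg_lt_zero.mpr hs)
  refine this.congr fun n => ?_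
  ring_nf

/-- The jumps of the circle on smooth functions. -/
def circleJumpS : Fin 3 → smoothPeriodic →ₗ[ℂ] smoothPeriodic := ![momentumS, phaseS 1, phaseS (-1)]

/-- The formal adjoints of the jumps of the circle. -/
def circleJumpAdjS : Fin 3 → smoothPeriodic →ₗ[ℂ] smoothPeriodic :=
  ![momentumS, phaseS (-1), phaseS 1]

theorem planeWave_mem_span (k : ℤ) : planeWave k ∈ Submodule.span ℂ (Set.range planeWave) :=
  Submodule.subset_span ⟨k, rfl⟩

theorem momentumS_mem_span (k : ℤ) :
    momentumS (planeWave k) ∈ Submodule.span ℂ (Set.range planeWave) := by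
  rw [momentumS_planeWave]
  exact Submodule.smul_mem _ _ (planeWave_mem_span k)

theorem phaseS_mem_span (j k : ℤ) :
    phaseS j (planeWave k) ∈ Submodule.span ℂ (Set.range planeWave) := by
  rw [phaseS_planeWave]
  exact planeWave_mem_span _

theorem circleJumpS_mem : ∀ (a : Fin 3) (k : ℤ),
    circleJumpS a (planeWave k) ∈ Submodule.span ℂ (Set.range planeWave)
  | 0, k => momentumS_mem_span k
  | 1, k => phaseS_mem_span 1 k
  | 2, k => phaseS_mem_span (-1) k

theorem circleJumpAdjS_mem : ∀ (a : Fin 3) (k : ℤ),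
    circleJumpAdjS a (planeWave k) ∈ Submodule.span ℂ (Set.range planeWave)
  | 0, k => momentumS_mem_span k
  | 1, k => phaseS_mem_span (-1) k
  | 2, k => phaseS_mem_span 1 k

theorem circleJumpS_adjoint (a : Fin 3) (u v : smoothPeriodic) :
    ⟪periodicToL2 (circleJumpAdjS a u), periodicToL2 v⟫_ℂ =
      ⟪periodicToL2 u, periodicToL2 (circleJumpS a v)⟫_ℂ := by
  match a with
  | 0 => exact momentumS_symm u v
  | 1 => exact phaseS_adjoint 1 u v
  | 2 =>
    have h := phaseS_adjoint (-1) u v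
    rw [neg_neg] at h
    exact h

theorem circleJumps_eq : ∀ a : Fin 3,
    circleJumps a = closedOp periodicToL2 periodicToL2_injective (circleJumpS a)
  | 0 => rfl
  | 1 => rfl
  | 2 => rfl

/-- The kernel of the closed form on the circle. -/
theorem circle_kernel {β : ℝ} (hβ : 0 < β) {f : ℝ → ℂ} {m : ℕ} (hm : 1 ≤ m) {n : ℕ}
    {K : L2Circle →L[ℂ] L2Circle} (hK : IsLowEnergyPerturbation (laplacianPow 1) n K)
    (hf : ∀ ν ∈ bohrFrequencies (addBounded (laplacianPow m) K), f ν ≠ 0)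
    (x : L2Circle →L[ℂ] L2Circle) :
    ClosedFormHasValue β f (addBounded (laplacianPow m) K) circleJumps x 0 ↔
      ∃ c : ℂ, x = c • expNeg (addBounded (laplacianPow m) K) (β / 2) := by
  have hψ := periodicToL2_planeWave
  have hvec : ∀ k, periodicToL2 (planeWave k) =
      (basisVec (fourierBasis (T := 2 * Real.pi)) k : L2Circle) := hψ
  refine isDiagonalCore_circle.closedForm_eq_zero_iff periodicToL2_injective (fun n => ?_)
    (fun s hs => ?_) hK (fun a => circleJumps_eq a ▸ isCoreJump_closedOp periodicToL2_injective hψ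
      (circleJumpS_mem a) (circleJumpAdjS_mem a) (circleJumpS_adjoint a)) ?_ hβ hf x
  · refine (Set.finite_Icc (-(n : ℤ)) n).subset fun k hk => ?_
    have h1 : k.natAbs ^ 2 ≤ n := hk
    have h2 : k.natAbs ≤ k.natAbs ^ 2 := Nat.le_self_pow two_ne_zero _
    rw [Set.mem_Icc]
    omega
  · have h1 : Summable fun k : ℤ => Real.exp (-(s * k.natAbs)) := by
      rw [summable_int_iff_summable_nat_and_neg]
      constructor <;> simpa using summable_exp_neg_natCast hs
    refine Summable.of_nonneg_of_le (fun _ => (Real.exp_pos _).le) (fun k => ?_) h1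
    refine Real.exp_le_exp.mpr (neg_le_neg (mul_le_mul_of_nonneg_left ?_ hs.le))
    have : k.natAbs ≤ (k.natAbs ^ 2) ^ m := by
      rw [← pow_mul]
      exact Nat.le_self_pow (by omega) _
    exact_mod_cast this
  · -- A form commuting with `D_x` is diagonal in the plane waves, since their momenta are distinct;
    -- commuting with `e^{ix}` makes the diagonal constant.
    intro Φ hΦ
    set b := basisVec (fourierBasis (T := 2 * Real.pi))
    have hmom : ∀ k, coreMap periodicToL2_injective hψ (circleJumpS 0) (circleJumpS_mem 0) (b k) =
        (k : ℂ) • b k := fun k => Subtype.ext (by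
      rw [coreMap_apply _ _ _ _ (planeWave k) _ (hvec k)]
      change periodicToL2 (momentumS (planeWave k)) = _
      rw [momentumS_planeWave, map_smul, hvec]
      rfl)
    have hmom' : ∀ k, coreMap periodicToL2_injective hψ (circleJumpAdjS 0) (circleJumpAdjS_mem 0)
        (b k) = (k : ℂ) • b k := hmom
    have hphase : ∀ k, coreMap periodicToL2_injective hψ (circleJumpS 1) (circleJumpS_mem 1) (b k) =
        b (1 + k) := fun k => Subtype.ext (by
      rw [coreMap_apply _ _ _ _ (planeWave k) _ (hvec k)]
      change periodicToL2 (phaseS 1 (planeWave k)) = _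
      rw [phaseS_planeWave, hvec])
    have hphase' : ∀ k, coreMap periodicToL2_injective hψ (circleJumpAdjS 1) (circleJumpAdjS_mem 1)
        (b k) = b (-1 + k) := fun k => Subtype.ext (by
      rw [coreMap_apply _ _ _ _ (planeWave k) _ (hvec k)]
      change periodicToL2 (phaseS (-1) (planeWave k)) = _
      rw [phaseS_planeWave, hvec])
    have hoff : ∀ k l, k ≠ l → Φ (b k) (b l) = 0 := by
      intro k l hkl
      have h := hΦ 0 (b k) (b l)
      rw [hmom', hmom, LinearMap.map_smulₛₗ, LinearMap.smul_apply, map_smul, map_intCast,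
        smul_eq_mul, smul_eq_mul, ← sub_eq_zero, ← sub_mul] at h
      refine (mul_eq_zero.mp h).resolve_left fun h0 => hkl ?_
      exact_mod_cast sub_eq_zero.mp h0
    have hstep : ∀ k : ℤ, Φ (b (1 + k)) (b (1 + k)) = Φ (b k) (b k) := by
      intro k
      have h := hΦ 1 (b (1 + k)) (b k)
      rw [hphase', hphase, neg_add_cancel_left] at h
      exact h.symm
    have hdiag : ∀ k, Φ (b k) (b k) = Φ (b 0) (b 0) := by
      intro k
      induction k with
      | zero => rfl
      | succ i ih => rw [add_comm, hstep, ih]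
      | pred i ih => rw [← ih, ← hstep (-(i : ℤ) - 1)]; ring_nf
    refine ⟨Φ (b 0) (b 0), fun k l => ?_⟩
    rw [inner_hilbertBasis]
    split_ifs with hkl
    · subst hkl
      rw [mul_one]
      exact hdiag k
    · rw [mul_zero]
      exact hoff k l hkl

end Circle

/-! ### Hermite functions -/

section Line

/-- The Gaussian `e^{-x²/2}`. -/
def gaussianFun (x : ℝ) : ℂ := Complex.exp (-((x : ℂ) ^ 2 / 2))

theorem hasDerivAt_gaussianFun (x : ℝ) :
    HasDerivAt gaussianFun (-(x : ℂ) * gaussianFun x) x := by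
  have h : HasDerivAt (fun x : ℝ => -((x : ℂ) ^ 2 / 2)) (-(2 * (x : ℂ) ^ 1 * 1 / 2)) x :=
    ((Complex.ofRealCLM.hasDerivAt.pow 2).div_const 2).neg
  refine h.cexp.congr_deriv ?_
  simp only [gaussianFun]
  ring

theorem norm_gaussianFun (x : ℝ) : ‖gaussianFun x‖ = Real.exp (-(x ^ 2 / 2)) := by
  have h : -((x : ℂ) ^ 2 / 2) = ((-(x ^ 2 / 2) : ℝ) : ℂ) := by push_cast; rfl
  rw [gaussianFun, Complex.norm_exp, h, Complex.ofReal_re]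

theorem contDiff_gaussianFun : ContDiff ℝ ∞ gaussianFun := by
  unfold gaussianFun
  exact Complex.contDiff_exp.comp ((Complex.ofRealCLM.contDiff.pow 2).div_const 2).neg

/-- Derivatives of the Gaussian are polynomials times the Gaussian, which gives its Schwartz
decay. -/
theorem iteratedDeriv_gaussianFun (n : ℕ) : ∃ p : Polynomial ℂ,
    iteratedDeriv n gaussianFun = fun x : ℝ => p.eval (x : ℂ) * gaussianFun x := by
  induction n with
  | zero => exact ⟨1, by simp⟩
  | succ n ih =>
    obtain ⟨p, hp⟩ := ih
    refine ⟨p.derivative - Polynomial.X * p, ?_⟩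
    rw [iteratedDeriv_succ, hp]
    funext x
    have h : HasDerivAt (fun x : ℝ => p.eval (x : ℂ)) (p.derivative.eval (x : ℂ)) x :=
      (p.hasDerivAt (x : ℂ)).comp_ofReal
    refine (h.mul (hasDerivAt_gaussianFun x)).deriv.trans ?_
    simp only [Polynomial.eval_sub, Polynomial.eval_mul, Polynomial.eval_X]
    ring

theorem abs_pow_mul_exp_le (n : ℕ) (x : ℝ) :
    |x| ^ n * Real.exp (-(x ^ 2 / 2)) ≤ n.factorial * Real.exp (1 / 2) := by
  have h1 : |x| ^ n ≤ n.factorial * Real.exp |x| := by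
    have := Real.pow_div_factorial_le_exp |x| (abs_nonneg x) n
    rwa [div_le_iff₀' (by positivity)] at this
  calc |x| ^ n * Real.exp (-(x ^ 2 / 2))
      ≤ (n.factorial * Real.exp |x|) * Real.exp (-(x ^ 2 / 2)) := by gcongr
    _ = n.factorial * Real.exp (|x| + -(x ^ 2 / 2)) := by rw [Real.exp_add]; ring
    _ ≤ n.factorial * Real.exp (1 / 2) := by
        gcongr
        nlinarith [sq_nonneg (|x| - 1), sq_abs x]

theorem exists_bound_polynomial_mul_gaussianFun (p : Polynomial ℂ) :
    ∃ C, ∀ x : ℝ, ‖p.eval (x : ℂ) * gaussianFun x‖ ≤ C := by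
  induction p using Polynomial.induction_on' with
  | add p q hp hq =>
    obtain ⟨C, hC⟩ := hp
    obtain ⟨D, hD⟩ := hq
    refine ⟨C + D, fun x => ?_⟩
    rw [Polynomial.eval_add, add_mul]
    exact (norm_add_le _ _).trans (add_le_add (hC x) (hD x))
  | monomial n a =>
    refine ⟨‖a‖ * (n.factorial * Real.exp (1 / 2)), fun x => ?_⟩
    rw [Polynomial.eval_monomial, norm_mul, norm_mul, norm_pow, norm_gaussianFun,
      Complex.norm_real, Real.norm_eq_abs, mul_assoc]
    exact mul_le_mul_of_nonneg_left (abs_pow_mul_exp_le n x) (norm_nonneg a)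

/-- The Gaussian as a Schwartz function. -/
def gaussianS : 𝓢(ℝ, ℂ) where
  toFun := gaussianFun
  smooth' := contDiff_gaussianFun
  decay' k n := by
    obtain ⟨p, hp⟩ := iteratedDeriv_gaussianFun n
    obtain ⟨C, hC⟩ := exists_bound_polynomial_mul_gaussianFun (Polynomial.X ^ k * p)
    refine ⟨C, fun x => le_trans (le_of_eq ?_) (hC x)⟩
    rw [norm_iteratedFDeriv_eq_norm_iteratedDeriv, hp]
    simp only [Polynomial.eval_mul, Polynomial.eval_pow, Polynomial.eval_X, norm_mul, norm_pow,
      Complex.norm_real, mul_assoc]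

theorem gaussianS_apply (x : ℝ) : gaussianS x = gaussianFun x := rfl

theorem positionS_apply (u : 𝓢(ℝ, ℂ)) (x : ℝ) : positionS u x = x * u x := by
  have h : (fun x : ℝ => (x : ℂ)).HasTemperateGrowth := by fun_prop
  exact SchwartzMap.smulLeftCLM_apply_apply h u x

theorem derivS_apply (u : 𝓢(ℝ, ℂ)) (x : ℝ) : derivS u x = deriv u x := rfl

theorem derivS_positionS (u : 𝓢(ℝ, ℂ)) : derivS (positionS u) = u + positionS (derivS u) := by
  ext x
  have h : (positionS u : ℝ → ℂ) = fun x : ℝ => (x : ℂ) * u x := funext (positionS_apply u)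
  rw [derivS_apply, h, add_apply, positionS_apply, derivS_apply]
  have h1 : HasDerivAt (fun x : ℝ => (x : ℂ) * u x) (1 * u x + (x : ℂ) * deriv u x) x :=
    Complex.ofRealCLM.hasDerivAt.mul u.differentiableAt.hasDerivAt
  rw [h1.deriv, one_mul]

theorem inv_sqrt_two_mul_self :
    ((1 / Real.sqrt 2 : ℝ) : ℂ) * ((1 / Real.sqrt 2 : ℝ) : ℂ) = 1 / 2 := by
  rw [← Complex.ofReal_mul, div_mul_div_comm, Real.mul_self_sqrt zero_le_two]
  push_cast
  norm_num

/-- The canonical commutation relation `a a† = a† a + 1`. -/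
theorem annihilationS_creationS (u : 𝓢(ℝ, ℂ)) :
    annihilationS (creationS u) = creationS (annihilationS u) + u := by
  simp only [annihilationS, creationS, LinearMap.smul_apply, LinearMap.add_apply,
    LinearMap.sub_apply, map_smul, map_add, map_sub, derivS_positionS, ← smul_add, ← smul_sub,
    smul_smul, inv_sqrt_two_mul_self]
  module

theorem inner_schwartzToL2 (u v : 𝓢(ℝ, ℂ)) :
    ⟪schwartzToL2 u, schwartzToL2 v⟫_ℂ = ∫ x, (starRingEnd ℂ) (u x) * v x := by
  rw [L2.inner_def]
  refine integral_congr_ae ?_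
  filter_upwards [u.coeFn_toLp 2 volume, v.coeFn_toLp 2 volume] with x hu hv
  change ⟪u.toLp 2 volume x, v.toLp 2 volume x⟫_ℂ = _
  rw [hu, hv, RCLike.inner_apply, mul_comm]

theorem positionS_symm (u v : 𝓢(ℝ, ℂ)) :
    ⟪schwartzToL2 (positionS u), schwartzToL2 v⟫_ℂ =
      ⟪schwartzToL2 u, schwartzToL2 (positionS v)⟫_ℂ := by
  rw [inner_schwartzToL2, inner_schwartzToL2]
  refine integral_congr_ae (ae_of_all _ fun x => ?_)
  simp only [positionS_apply, map_mul, Complex.conj_ofReal]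
  ring

theorem derivS_antisymm (u v : 𝓢(ℝ, ℂ)) :
    ⟪schwartzToL2 (derivS u), schwartzToL2 v⟫_ℂ =
      -⟪schwartzToL2 u, schwartzToL2 (derivS v)⟫_ℂ := by
  rw [inner_schwartzToL2, inner_schwartzToL2, eq_neg_iff_add_eq_zero, add_comm,
    ← eq_neg_iff_add_eq_zero]
  exact SchwartzMap.integral_bilinear_deriv_right_eq_neg_left u v
    ((ContinuousLinearMap.mul ℝ ℂ).comp (Complex.conjCLE : ℂ →L[ℝ] ℂ))

theorem annihilationS_adjoint (u v : 𝓢(ℝ, ℂ)) :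
    ⟪schwartzToL2 (annihilationS u), schwartzToL2 v⟫_ℂ =
      ⟪schwartzToL2 u, schwartzToL2 (creationS v)⟫_ℂ := by
  simp only [annihilationS, creationS, LinearMap.smul_apply, LinearMap.add_apply,
    LinearMap.sub_apply, map_smul, map_add, map_sub, inner_smul_left, inner_smul_right,
    inner_add_left, inner_sub_right, Complex.conj_ofReal, positionS_symm, derivS_antisymm]
  ring

theorem creationS_adjoint (u v : 𝓢(ℝ, ℂ)) :
    ⟪schwartzToL2 (creationS u), schwartzToL2 v⟫_ℂ =
      ⟪schwartzToL2 u, schwartzToL2 (annihilationS v)⟫_ℂ := by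
  rw [← inner_conj_symm, ← annihilationS_adjoint, inner_conj_symm]

theorem annihilationS_gaussianS : annihilationS gaussianS = 0 := by
  ext x
  have h : deriv gaussianS x = -(x : ℂ) * gaussianFun x := (hasDerivAt_gaussianFun x).deriv
  have h2 : (positionS + derivS) gaussianS x = 0 := by
    rw [LinearMap.add_apply, add_apply, positionS_apply, derivS_apply, h,
      gaussianS_apply]
    ring
  rw [annihilationS, LinearMap.smul_apply, smul_apply, h2, smul_zero]
  rfl

/-- The normalized Hermite functions, generated from the Gaussian by the creation operator. -/
def hermiteS : ℕ → 𝓢(ℝ, ℂ)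
  | 0 => ((‖schwartzToL2 gaussianS‖⁻¹ : ℝ) : ℂ) • gaussianS
  | k + 1 => ((Real.sqrt (k + 1))⁻¹ : ℂ) • creationS (hermiteS k)

theorem sqrt_succ_ne_zero (k : ℕ) : (Real.sqrt (k + 1) : ℂ) ≠ 0 := by
  exact_mod_cast (Real.sqrt_pos.mpr (by positivity)).ne'

theorem sqrt_succ_mul_self (k : ℕ) :
    (Real.sqrt (k + 1) : ℂ) * (Real.sqrt (k + 1) : ℂ) = k + 1 := by
  rw [← Complex.ofReal_mul, Real.mul_self_sqrt (by positivity)]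
  push_cast
  rfl

theorem norm_gaussianS_ne_zero : (‖schwartzToL2 gaussianS‖ : ℂ) ≠ 0 := by
  rw [Complex.ofReal_ne_zero, norm_ne_zero_iff, Ne, map_eq_zero_iff _ schwartzToL2_injective]
  intro h0
  have h1 : gaussianFun 0 = 0 := DFunLike.congr_fun h0 0
  simp [gaussianFun] at h1

theorem creationS_hermiteS (k : ℕ) :
    creationS (hermiteS k) = (Real.sqrt (k + 1) : ℂ) • hermiteS (k + 1) := by
  rw [hermiteS, smul_inv_smul₀ (sqrt_succ_ne_zero k)]

theorem annihilationS_hermiteS_zero : annihilationS (hermiteS 0) = 0 := by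
  rw [hermiteS, map_smul, annihilationS_gaussianS, smul_zero]

theorem annihilationS_creationS_of_number {k : ℕ}
    (h : creationS (annihilationS (hermiteS k)) = (k : ℂ) • hermiteS k) :
    annihilationS (creationS (hermiteS k)) = ((k : ℂ) + 1) • hermiteS k := by
  rw [annihilationS_creationS, h, add_smul, one_smul]

theorem annihilationS_hermiteS_of_number {k : ℕ}
    (h : creationS (annihilationS (hermiteS k)) = (k : ℂ) • hermiteS k) :
    annihilationS (hermiteS (k + 1)) = (Real.sqrt (k + 1) : ℂ) • hermiteS k := by
  rw [hermiteS, map_smul, annihilationS_creationS_of_number h, smul_smul,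
    ← sqrt_succ_mul_self, inv_mul_cancel_left₀ (sqrt_succ_ne_zero k)]

theorem number_hermiteS (k : ℕ) :
    creationS (annihilationS (hermiteS k)) = (k : ℂ) • hermiteS k := by
  induction k with
  | zero => rw [annihilationS_hermiteS_zero, map_zero, Nat.cast_zero, zero_smul]
  | succ k ih =>
    rw [annihilationS_hermiteS_of_number ih, map_smul, creationS_hermiteS, smul_smul,
      sqrt_succ_mul_self, Nat.cast_succ]

theorem annihilationS_hermiteS_succ (k : ℕ) :
    annihilationS (hermiteS (k + 1)) = (Real.sqrt (k + 1) : ℂ) • hermiteS k :=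
  annihilationS_hermiteS_of_number (number_hermiteS k)

theorem number_symm (u v : 𝓢(ℝ, ℂ)) :
    ⟪schwartzToL2 ((creationS * annihilationS) u), schwartzToL2 v⟫_ℂ =
      ⟪schwartzToL2 u, schwartzToL2 ((creationS * annihilationS) v)⟫_ℂ := by
  rw [Module.End.mul_apply, Module.End.mul_apply, creationS_adjoint, annihilationS_adjoint]

theorem orthonormal_hermiteS : Orthonormal ℂ fun k => schwartzToL2 (hermiteS k) := by
  rw [orthonormal_iff_ite]
  intro j k
  split_ifs with h
  · subst h
    induction j with
    | zero =>
      rw [hermiteS, map_smul, inner_smul_left, inner_smul_right, inner_self_eq_norm_sq_to_K,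
        Complex.conj_ofReal]
      have hne := norm_gaussianS_ne_zero
      push_cast
      field_simp
      rfl
    | succ j ih =>
      have h1 : ⟪schwartzToL2 (creationS (hermiteS j)), schwartzToL2 (creationS (hermiteS j))⟫_ℂ =
          j + 1 := by
        rw [creationS_adjoint, annihilationS_creationS_of_number (number_hermiteS j),
          map_smul, inner_smul_right, ih, mul_one]
      rw [creationS_hermiteS, map_smul, inner_smul_left, inner_smul_right, Complex.conj_ofReal,
        ← mul_assoc, sqrt_succ_mul_self] at h1
      have h2 : (j : ℂ) + 1 ≠ 0 := by exact_mod_cast Nat.succ_ne_zero j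
      exact mul_left_cancel₀ h2 (h1.trans (mul_one _).symm)
  · have h1 := number_symm (hermiteS j) (hermiteS k)
    rw [Module.End.mul_apply, Module.End.mul_apply, number_hermiteS, number_hermiteS, map_smul,
      map_smul, inner_smul_left, inner_smul_right, Complex.conj_natCast, ← sub_eq_zero,
      ← sub_mul] at h1
    refine (mul_eq_zero.mp h1).resolve_left fun h0 => h ?_
    exact_mod_cast sub_eq_zero.mp h0

theorem hermiteS_mem_span (k : ℕ) : hermiteS k ∈ Submodule.span ℂ (Set.range hermiteS) :=
  Submodule.subset_span ⟨k, rfl⟩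

theorem creationS_mem_span (k : ℕ) :
    creationS (hermiteS k) ∈ Submodule.span ℂ (Set.range hermiteS) := by
  rw [creationS_hermiteS]
  exact Submodule.smul_mem _ _ (hermiteS_mem_span _)

theorem annihilationS_mem_span (k : ℕ) :
    annihilationS (hermiteS k) ∈ Submodule.span ℂ (Set.range hermiteS) := by
  cases k with
  | zero => rw [annihilationS_hermiteS_zero]; exact Submodule.zero_mem _
  | succ k =>
    rw [annihilationS_hermiteS_succ]
    exact Submodule.smul_mem _ _ (hermiteS_mem_span _)

theorem positionS_eq : positionS = ((1 / Real.sqrt 2 : ℝ) : ℂ) • (annihilationS + creationS) := by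
  have h := inv_sqrt_two_mul_self
  refine LinearMap.ext fun u => ?_
  simp only [annihilationS, creationS, LinearMap.smul_apply, LinearMap.add_apply,
    LinearMap.sub_apply, ← smul_add, smul_smul, h]
  module

/-- The span of the Hermite functions contains all `x^k e^{-x²/2}`. -/
theorem positionS_pow_gaussianS_mem (k : ℕ) :
    (positionS ^ k) gaussianS ∈ Submodule.span ℂ (Set.range hermiteS) := by
  have hpos : Submodule.span ℂ (Set.range hermiteS) ≤
      (Submodule.span ℂ (Set.range hermiteS)).comap positionS := by
    refine span_le_comap fun k => ?_
    rw [positionS_eq]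
    exact Submodule.smul_mem _ _
      (Submodule.add_mem _ (annihilationS_mem_span k) (creationS_mem_span k))
  induction k with
  | zero =>
    have h1 : gaussianS = (‖schwartzToL2 gaussianS‖ : ℂ) • hermiteS 0 := by
      rw [hermiteS, Complex.ofReal_inv, smul_inv_smul₀ norm_gaussianS_ne_zero]
    rw [pow_zero, Module.End.one_apply, h1]
    exact Submodule.smul_mem _ _ (hermiteS_mem_span 0)
  | succ k ih =>
    rw [pow_succ', Module.End.mul_apply]
    exact hpos ih

theorem positionS_pow_apply (k : ℕ) (u : 𝓢(ℝ, ℂ)) (x : ℝ) :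
    (positionS ^ k) u x = (x : ℂ) ^ k * u x := by
  induction k with
  | zero => simp
  | succ k ih => rw [pow_succ', Module.End.mul_apply, positionS_apply, ih]; ring

end Line

/-! ### Completeness of the Hermite functions -/

section Completeness

open scoped FourierTransform

/-- An integrable function on the line whose Fourier transform vanishes is zero almost
everywhere. -/
theorem ae_eq_zero_of_fourier_eq_zero {h : ℝ → ℂ} (hh : Integrable h) (h0 : ∀ w, 𝓕 h w = 0) :
    ∀ᵐ x, h x = 0 := by
  -- Test against a bump function `φ`, written as a Fourier transform, and move the
  -- transform to `h`.
  refine ae_eq_zero_of_integral_contDiff_smul_eq_zero hh.locallyIntegrable fun φ hφ hφs => ?_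
  let φc : ℝ → ℂ := fun x => (φ x : ℂ)
  have hs : HasCompactSupport φc := hφs.comp_left (g := fun r : ℝ => (r : ℂ)) Complex.ofReal_zero
  have hd : ContDiff ℝ ∞ φc := Complex.ofRealCLM.contDiff.comp hφ
  let φS : 𝓢(ℝ, ℂ) := hs.toSchwartzMap hd
  have hswap := VectorFourier.integral_fourierIntegral_smul_eq_flip (μ := volume) (ν := volume)
    (L := innerₗ ℝ) (f := (𝓕⁻ φS : 𝓢(ℝ, ℂ))) (g := h) Real.continuous_fourierChar
    continuous_inner (SchwartzMap.integrable _) hh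
  have hflip : VectorFourier.fourierIntegral Real.fourierChar volume (innerₗ ℝ).flip h = 𝓕 h := by
    rw [flip_innerₗ]
    rfl
  have hinv : VectorFourier.fourierIntegral Real.fourierChar volume (innerₗ ℝ)
      (𝓕⁻ φS : 𝓢(ℝ, ℂ)) = φS := by
    have : 𝓕 (𝓕⁻ φS : 𝓢(ℝ, ℂ)) = φS := FourierTransform.fourier_fourierInv_eq φS
    conv_rhs => rw [← this]
    rfl
  rw [hflip, hinv] at hswap
  have hleft : ∫ x, φ x • h x = ∫ x, φS x • h x := rfl
  rw [hleft, hswap]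
  simp [h0]

/-- The Gaussian tames every exponential, so `e^{c|x|}` times `e^{-x²/2} f` is integrable for `f` in
`L²`. -/
theorem integrable_exp_mul_gaussianFun (f : L2Line) (c : ℝ) :
    Integrable fun x => Real.exp (c * |x|) * ‖gaussianFun x * f x‖ := by
  have hw : MemLp (fun x : ℝ => Real.exp (c * |x|) * ‖gaussianFun x‖) 2 := by
    have h1 : MemLp (fun x : ℝ => Real.exp (c ^ 2) * Real.exp (-(1 / 4) * x ^ 2)) 2 := by
      refine MemLp.const_mul ?_ _
      rw [memLp_two_iff_integrable_sq (by fun_prop)]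
      refine (integrable_exp_neg_mul_sq (b := 1 / 2) (by norm_num)).congr (ae_of_all _ fun x => ?_)
      simp only
      rw [← Real.exp_nat_mul]
      congr 1
      push_cast
      ring
    refine h1.of_le ?_ (ae_of_all _ fun x => ?_)
    · have := contDiff_gaussianFun.continuous
      fun_prop
    · rw [norm_gaussianFun, ← Real.exp_add, ← Real.exp_add, Real.norm_eq_abs, Real.norm_eq_abs,
        Real.abs_exp, Real.abs_exp, Real.exp_le_exp]
      -- `c |x| ≤ c² + x² / 4`
      nlinarith [sq_nonneg (c - |x| / 2), sq_abs x]
  have := hw.integrable_mul (Lp.memLp f).norm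
  refine this.congr (ae_of_all _ fun x => ?_)
  simp only [Pi.mul_apply, norm_mul]
  ring

theorem integrable_gaussianFun_mul (f : L2Line) : Integrable fun x => gaussianFun x * f x := by
  have h := integrable_exp_mul_gaussianFun f 0
  simp only [zero_mul, Real.exp_zero, one_mul] at h
  refine (integrable_norm_iff ?_).mp h
  exact contDiff_gaussianFun.continuous.aestronglyMeasurable.mul (Lp.aestronglyMeasurable f)

/-- The moments of `e^{-x²/2} f` determine its Fourier transform, through the power series of the
exponential. -/
theorem fourier_gaussianFun_mul_eq_zero {f : L2Line}
    (hf : ∀ k : ℕ, ∫ x : ℝ, (x : ℂ) ^ k * (gaussianFun x * f x) = 0) (w : ℝ) :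
    𝓕 (fun x => gaussianFun x * f x) w = 0 := by
  rw [Real.fourier_real_eq_integral_exp_smul]
  let z : ℂ := ((-2 * Real.pi * w : ℝ) : ℂ) * Complex.I
  have hmeas := (integrable_gaussianFun_mul f).aestronglyMeasurable
  -- Expand `e^{zx}` and integrate term by term, with the terms of `e^{|z||x|}` as a
  -- dominating series.
  have hbound : ∀ x : ℝ, HasSum (fun n : ℕ => (‖z‖ * |x|) ^ n / n.factorial *
      ‖gaussianFun x * f x‖) (Real.exp (‖z‖ * |x|) * ‖gaussianFun x * f x‖) := by
    intro x
    have := NormedSpace.expSeries_div_hasSum_exp (‖z‖ * |x|)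
    rw [← Real.exp_eq_exp_ℝ] at this
    exact this.mul_right _
  have key := hasSum_integral_of_dominated_convergence (μ := volume)
    (F := fun (n : ℕ) (x : ℝ) => (z * x) ^ n / n.factorial * (gaussianFun x * f x))
    (f := fun x : ℝ => Complex.exp (z * x) * (gaussianFun x * f x))
    (fun n x => (‖z‖ * |x|) ^ n / n.factorial * ‖gaussianFun x * f x‖)
    (fun n => by
      refine AEStronglyMeasurable.mul ?_ hmeas
      have : Continuous fun x : ℝ => (z * x) ^ n / (n.factorial : ℂ) := by fun_prop
      exact this.aestronglyMeasurable)
    (fun n => ae_of_all _ fun x => by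
      rw [norm_mul, norm_div, norm_pow, norm_mul, Complex.norm_real, Complex.norm_natCast,
        Real.norm_eq_abs])
    (ae_of_all _ fun x => (hbound x).summable)
    (by
      simp_rw [fun x => (hbound x).tsum_eq]
      exact integrable_exp_mul_gaussianFun f ‖z‖)
    (ae_of_all _ fun x => by
      have := NormedSpace.expSeries_div_hasSum_exp (z * x)
      rw [← Complex.exp_eq_exp_ℂ] at this
      exact this.mul_right _)
  have hzero : ∀ n : ℕ, ∫ x : ℝ, (z * x) ^ n / n.factorial * (gaussianFun x * f x) = 0 := by
    intro n
    have : (fun x : ℝ => (z * x) ^ n / n.factorial * (gaussianFun x * f x)) =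
        fun x : ℝ => (z ^ n / n.factorial) * ((x : ℂ) ^ n * (gaussianFun x * f x)) := by
      funext x
      rw [mul_pow]
      ring
    rw [this, integral_const_mul, hf, mul_zero]
  simp_rw [hzero] at key
  refine Eq.trans (integral_congr_ae (ae_of_all _ fun x => ?_)) (key.unique hasSum_zero)
  simp only [z, smul_eq_mul]
  congr 2
  push_cast
  ring

/-- Completeness of the Hermite functions: a function `f` orthogonal to all of them is orthogonal to
all `x^k e^{-x²/2}`, so the Fourier transform of `e^{-x²/2} f` vanishes. -/
theorem eq_zero_of_forall_inner_hermiteS {f : L2Line}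
    (hf : ∀ k, ⟪schwartzToL2 (hermiteS k), f⟫_ℂ = 0) : f = 0 := by
  have hspan : ∀ u ∈ Submodule.span ℂ (Set.range hermiteS), ⟪schwartzToL2 u, f⟫_ℂ = 0 := by
    intro u hu
    induction hu using Submodule.span_induction with
    | mem u hu => obtain ⟨k, rfl⟩ := hu; exact hf k
    | zero => simp
    | add u v _ _ hu hv => rw [map_add, inner_add_left, hu, hv, add_zero]
    | smul c u _ hu => rw [map_smul, inner_smul_left, hu, mul_zero]
  have hreal : ∀ x, (starRingEnd ℂ) (gaussianFun x) = gaussianFun x := by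
    intro x
    have : gaussianFun x = (Real.exp (-(x ^ 2 / 2)) : ℝ) := by
      rw [gaussianFun]
      push_cast
      ring_nf
    rw [this, Complex.conj_ofReal]
  have hmom : ∀ k : ℕ, ∫ x : ℝ, (x : ℂ) ^ k * (gaussianFun x * f x) = 0 := by
    intro k
    rw [← hspan _ (positionS_pow_gaussianS_mem k), L2.inner_def]
    refine integral_congr_ae ?_
    filter_upwards [((positionS ^ k) gaussianS).coeFn_toLp 2 volume] with x hx
    change _ = ⟪((positionS ^ k) gaussianS).toLp 2 volume x, f x⟫_ℂ
    rw [hx, RCLike.inner_apply, positionS_pow_apply, gaussianS_apply, map_mul, map_pow,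
      Complex.conj_ofReal, hreal]
    ring
  have h0 := ae_eq_zero_of_fourier_eq_zero (integrable_gaussianFun_mul f)
    (fourier_gaussianFun_mul_eq_zero hmom)
  refine Lp.ext ?_
  filter_upwards [h0, Lp.coeFn_zero ℂ 2 (volume : Measure ℝ)] with x hx hx0
  rw [hx0]
  exact (mul_eq_zero.mp hx).resolve_left (Complex.exp_ne_zero _)

/-- The Hermite functions as a Hilbert basis of `L²(ℝ)`. -/
def hermiteBasis : HilbertBasis ℕ ℂ L2Line :=
  HilbertBasis.mkOfOrthogonalEqBot orthonormal_hermiteS (by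
    rw [Submodule.eq_bot_iff]
    intro f hf
    refine eq_zero_of_forall_inner_hermiteS fun k => ?_
    exact (Submodule.mem_orthogonal _ _).mp hf _ (Submodule.subset_span ⟨k, rfl⟩))

theorem schwartzToL2_hermiteS (k : ℕ) : schwartzToL2 (hermiteS k) = hermiteBasis k := by
  rw [hermiteBasis, HilbertBasis.coe_mkOfOrthogonalEqBot]

end Completeness

/-! ### The line -/

section LineKernel

/-- The Hermite functions diagonalize `a† a`, with eigenvalues `0, 1, 2, …`. -/
theorem isDiagonalCore_line : IsDiagonalCore schwartzToL2 (creationS * annihilationS) hermiteS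
    hermiteBasis fun k => k where
  basis := schwartzToL2_hermiteS
  diag k := number_hermiteS k
  symm := number_symm

/-- The jumps of the line on Schwartz functions. -/
def lineJumpS : Fin 2 → 𝓢(ℝ, ℂ) →ₗ[ℂ] 𝓢(ℝ, ℂ) := ![annihilationS, creationS]

/-- The formal adjoints of the jumps of the line. -/
def lineJumpAdjS : Fin 2 → 𝓢(ℝ, ℂ) →ₗ[ℂ] 𝓢(ℝ, ℂ) := ![creationS, annihilationS]

theorem lineJumpS_mem : ∀ (a : Fin 2) (k : ℕ),
    lineJumpS a (hermiteS k) ∈ Submodule.span ℂ (Set.range hermiteS)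
  | 0, k => annihilationS_mem_span k
  | 1, k => creationS_mem_span k

theorem lineJumpAdjS_mem : ∀ (a : Fin 2) (k : ℕ),
    lineJumpAdjS a (hermiteS k) ∈ Submodule.span ℂ (Set.range hermiteS)
  | 0, k => creationS_mem_span k
  | 1, k => annihilationS_mem_span k

theorem lineJumpS_adjoint : ∀ (a : Fin 2) (u v : 𝓢(ℝ, ℂ)),
    ⟪schwartzToL2 (lineJumpAdjS a u), schwartzToL2 v⟫_ℂ =
      ⟪schwartzToL2 u, schwartzToL2 (lineJumpS a v)⟫_ℂ
  | 0, u, v => creationS_adjoint u v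
  | 1, u, v => annihilationS_adjoint u v

theorem lineJumps_eq : ∀ a : Fin 2,
    lineJumps a = closedOp schwartzToL2 schwartzToL2_injective (lineJumpS a)
  | 0 => rfl
  | 1 => rfl

/-- The kernel of the closed form on the line. -/
theorem line_kernel {β : ℝ} (hβ : 0 < β) {f : ℝ → ℂ} {m : ℕ} (hm : 1 ≤ m) {n : ℕ}
    {K : L2Line →L[ℂ] L2Line} (hK : IsLowEnergyPerturbation (numberPow 1) n K)
    (hf : ∀ ν ∈ bohrFrequencies (addBounded (numberPow m) K), f ν ≠ 0)
    (x : L2Line →L[ℂ] L2Line) :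
    ClosedFormHasValue β f (addBounded (numberPow m) K) lineJumps x 0 ↔
      ∃ c : ℂ, x = c • expNeg (addBounded (numberPow m) K) (β / 2) := by
  have hψ := schwartzToL2_hermiteS
  have hvec : ∀ k, schwartzToL2 (hermiteS k) = (basisVec hermiteBasis k : L2Line) := hψ
  refine isDiagonalCore_line.closedForm_eq_zero_iff schwartzToL2_injective (fun n => ?_)
    (fun s hs => ?_) hK (fun a => lineJumps_eq a ▸ isCoreJump_closedOp schwartzToL2_injective hψ
      (lineJumpS_mem a) (lineJumpAdjS_mem a) (lineJumpS_adjoint a)) ?_ hβ hf x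
  · exact Set.finite_Iic n
  · refine Summable.of_nonneg_of_le (fun _ => (Real.exp_pos _).le) (fun k => ?_)
      (summable_exp_neg_natCast hs)
    refine Real.exp_le_exp.mpr (neg_le_neg (mul_le_mul_of_nonneg_left ?_ hs.le))
    exact_mod_cast Nat.le_self_pow (by omega) k
  · -- A form commuting with `a` and `a†` commutes with `N`, hence is diagonal in the Hermite
    -- functions, and comparing neighbouring levels through `a†` makes the diagonal constant.
    intro Φ hΦ
    set b := basisVec hermiteBasis
    let a := coreMap schwartzToL2_injective hψ annihilationS annihilationS_mem_span
    let c := coreMap schwartzToL2_injective hψ creationS creationS_mem_span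
    have ha : ∀ k : ℕ, a (b (k + 1)) = (Real.sqrt (k + 1) : ℂ) • b k := fun k => Subtype.ext (by
      rw [coreMap_apply _ _ _ _ (hermiteS (k + 1)) _ (hvec _), annihilationS_hermiteS_succ,
        map_smul, hvec]
      rfl)
    have hc : ∀ k : ℕ, c (b k) = (Real.sqrt (k + 1) : ℂ) • b (k + 1) := fun k => Subtype.ext (by
      rw [coreMap_apply _ _ _ _ (hermiteS k) _ (hvec _), creationS_hermiteS, map_smul, hvec]
      rfl)
    have hn : ∀ k : ℕ, c (a (b k)) = (k : ℂ) • b k := fun k => Subtype.ext (by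
      have h1 : schwartzToL2 (annihilationS (hermiteS k)) = a (b k) :=
        (coreMap_apply _ _ _ _ (hermiteS k) _ (hvec _)).symm
      rw [coreMap_apply _ _ _ _ _ _ h1, number_hermiteS, map_smul, hvec]
      rfl)
    have h0 : ∀ u v, Φ (c u) v = Φ u (a v) := hΦ 0
    have h1 : ∀ u v, Φ (a u) v = Φ u (c v) := hΦ 1
    have hoff : ∀ k l, k ≠ l → Φ (b k) (b l) = 0 := by
      intro k l hkl
      have h : Φ (c (a (b k))) (b l) = Φ (b k) (c (a (b l))) := by rw [h0, h1]
      rw [hn, hn, LinearMap.map_smulₛₗ, LinearMap.smul_apply, map_smul, map_natCast, smul_eq_mul,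
        smul_eq_mul, ← sub_eq_zero, ← sub_mul] at h
      refine (mul_eq_zero.mp h).resolve_left fun h0 => hkl ?_
      exact_mod_cast sub_eq_zero.mp h0
    have hdiag : ∀ k, Φ (b k) (b k) = Φ (b 0) (b 0) := by
      intro k
      induction k with
      | zero => rfl
      | succ k ih =>
        have h := h0 (b k) (b (k + 1))
        rw [ha, hc, LinearMap.map_smulₛₗ, LinearMap.smul_apply, map_smul, Complex.conj_ofReal,
          smul_eq_mul, smul_eq_mul] at h
        rw [← ih]
        exact mul_left_cancel₀ (sqrt_succ_ne_zero k) h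
    refine ⟨Φ (b 0) (b 0), fun k l => ?_⟩
    rw [inner_hilbertBasis]
    split_ifs with hkl
    · subst hkl
      rw [mul_one]
      exact hdiag k
    · rw [mul_zero]
      exact hoff k l hkl

end LineKernel

end GibbsSampler

end

theorem mainTheorem3 (β : ℝ) (hβ : 0 < β) (f : ℝ → ℂ) (hf : GibbsSampler.IsFilterFunction β f)
    (m : ℕ) (hm : 1 ≤ m) (n : ℕ) :
    (∀ K : GibbsSampler.L2Line →L[ℂ] GibbsSampler.L2Line,
      GibbsSampler.IsLowEnergyPerturbation (GibbsSampler.numberPow 1) n K →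
      ∀ H : GibbsSampler.L2Line →ₗ.[ℂ] GibbsSampler.L2Line,
      H = GibbsSampler.addBounded (GibbsSampler.numberPow m) K →
      (∀ ν ∈ GibbsSampler.bohrFrequencies H, f ν ≠ 0) →
      ∀ x : GibbsSampler.L2Line →L[ℂ] GibbsSampler.L2Line,
        GibbsSampler.ClosedFormHasValue β f H GibbsSampler.lineJumps x 0 ↔
          ∃ c : ℂ, x = c • GibbsSampler.expNeg H (β / 2)) ∧
    (∀ K : GibbsSampler.L2Circle →L[ℂ] GibbsSampler.L2Circle,
      GibbsSampler.IsLowEnergyPerturbation (GibbsSampler.laplacianPow 1) n K →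
      ∀ H : GibbsSampler.L2Circle →ₗ.[ℂ] GibbsSampler.L2Circle,
      H = GibbsSampler.addBounded (GibbsSampler.laplacianPow m) K →
      (∀ ν ∈ GibbsSampler.bohrFrequencies H, f ν ≠ 0) →
      ∀ x : GibbsSampler.L2Circle →L[ℂ] GibbsSampler.L2Circle,
        GibbsSampler.ClosedFormHasValue β f H GibbsSampler.circleJumps x 0 ↔
          ∃ c : ℂ, x = c • GibbsSampler.expNeg H (β / 2)) := by
  refine ⟨fun K hK H hH hν x => ?_, fun K hK H hH hν x => ?_⟩
  · subst hH
    exact GibbsSampler.line_kernel hβ hm hK hν x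
  · subst hH
    exact GibbsSampler.circle_kernel hβ hm hK hν x
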